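/- Write $\langle y\rangle=1+|y|$, and let $\widehat u(\xi,\tau)=\int_{\mathbb R^2}e^{-i(x\xi+t\tau)}u(x,t)\,dx\,dt$ denote the space-time Fourier transform on $\mathbb R_x\times\mathbb R_t$, extended to tempered distributions. For real $k,b,r,s$ and a tempered distribution $u$ on $\mathbb R^2$ whose Fourier transform is a function put $$\|u\|_{X^{k,b}}=\Big(\int_{\mathbb R^2}\langle\xi\rangle^{2k}\big\langle\tau+\tfrac12\xi^2\big\rangle^{2b}|\widehat u(\xi,\tau)|^2\,d\xi\,d\tau\Big)^{1/2},\qquad \|u\|_{H^r_tH^s_x}=\Big(\int_{\mathbb R^2}\langle\xi\rangle^{2s}\langle\tau\rangle^{2r}|\widehat u(\xi,\tau)|^2\,d\xi\,d\tau\Big)^{1/2},$$ and let $X^{k,b}$ be the space of those $u$ for which the first norm is finite. Let $k,s,a,b\in\mathbb R$ satisfy $$\max\{0,s\}<2k+\tfrac12,\qquad s\le k+\tfrac12,\qquad b>\tfrac12,\qquad \max\big\{\tfrac14,\max\{0,s\}-2k\big\}<a<\tfrac12 .$$ Then there is a constant $C$, depending only on $k,s,a,b$, such that $$\|u\bar w\|_{H^{-a}_tH^s_x}\le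 C\,\|u\|_{X^{k,b}}\|w\|_{X^{k,b}}$$ for all Schwartz functions $u,w$ on $\mathbb R^2$, and more generally for all $u,w\in X^{k,b}$. In the latter case the product $u\bar w$ is the tempered distribution with Fourier transform $(2\pi)^{-2}\,\widehat u*\widehat{\bar w}$; part of the claim is that this convolution converges absolutely almost everywhere and is the Fourier transform of a tempered distribution. -/

import Mathlib

open MeasureTheory SchwartzMap
open scoped FourierTransform ENNReal NNReal ComplexConjugate

noncomputable section

/-- The plane `ℝ²`. In physical space a point is `(x, t) = (z 0, z 1)`; on the Fourier side it is
`(ξ, τ) = (ζ 0, ζ 1)`. The volume is Lebesgue measure. -/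
abbrev Plane : Type := EuclideanSpace ℝ (Fin 2)

/-- The bracket `⟨y⟩ = 1 + |y|`. -/
def bracket (y : ℝ) : ℝ := 1 + |y|

/-- The function `F` is the Fourier transform `û` of the tempered distribution `u`, in the
normalization `û(ξ, τ) = ∫∫ e^{-i(xξ + tτ)} u(x, t) dx dt`. Mathlib's transform `𝓕` uses
`e^{-2πi(xξ + tτ)}`, so that `𝓕 u (η) = û(2πη)`; the identity is an identity of distributions. -/
def HasFourierFunction (u : 𝓢'(Plane, ℂ)) (F : Plane → ℂ) : Prop :=
  ∀ φ : 𝓢(Plane, ℂ),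
    Integrable (fun η : Plane => F ((2 * Real.pi) • η) * φ η) ∧
      (𝓕 u) φ = ∫ η : Plane, F ((2 * Real.pi) • η) * φ η

/-- `(∫∫ m(ξ, τ)² |û(ξ, τ)|² dξ dτ)^{1/2}`, and `∞` if `û` is not a function. (The function `û` is
unique up to null sets, so the infimum has at most one value.) -/
def weightedFourierNorm (m : Plane → ℝ) (u : 𝓢'(Plane, ℂ)) : ℝ≥0∞ :=
  ⨅ (F : Plane → ℂ) (_ : HasFourierFunction u F), eLpNorm (fun ζ => (m ζ : ℂ) * F ζ) 2 volume

/-- The norm of the Bourgain space `X^{k,b}` of the group `e^{it∂ₓ²/2}`, with the weight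
`⟨ξ⟩^k ⟨τ + ξ²/2⟩^b`. The space itself consists of the `u` for which it is finite. -/
def bourgainNorm (k b : ℝ) (u : 𝓢'(Plane, ℂ)) : ℝ≥0∞ :=
  weightedFourierNorm (fun ζ => bracket (ζ 0) ^ k * bracket (ζ 1 + ζ 0 ^ 2 / 2) ^ b) u

/-- The norm of `H^r_t H^s_x`, with the weight `⟨ξ⟩^s ⟨τ⟩^r`. -/
def mixedSobolevNorm (r s : ℝ) (u : 𝓢'(Plane, ℂ)) : ℝ≥0∞ :=
  weightedFourierNorm (fun ζ => bracket (ζ 0) ^ s * bracket (ζ 1) ^ r) u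

/-- The pointwise complex conjugate of a Schwartz function. -/
def schwartzConj : 𝓢(Plane, ℂ) →L[ℝ] 𝓢(Plane, ℂ) :=
  SchwartzMap.postcompCLM (𝕜 := ℝ) (Complex.conjCLE : ℂ →L[ℝ] ℂ)

/-- The complex conjugate of a tempered distribution: `⟨w̄, φ⟩` is the conjugate of `⟨w, φ̄⟩`. -/
def distribConj (w : 𝓢'(Plane, ℂ)) : 𝓢'(Plane, ℂ) :=
  ContinuousLinearMap.toPointwiseConvergenceCLM _ _ _ _
    { toFun := fun φ => conj (w (schwartzConj φ))
      map_add' := fun φ ψ => by simp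
      map_smul' := fun c φ => by
        have h : schwartzConj (c • φ) = conj c • schwartzConj φ := by
          ext z
          simp [schwartzConj]
        simp [h]
      cont := Complex.continuous_conj.comp
        ((ContinuousLinearMap.continuous _).comp schwartzConj.continuous) }

/-- The pointwise product of two Schwartz functions. -/
def schwartzMul (u w : 𝓢(Plane, ℂ)) : 𝓢(Plane, ℂ) :=
  SchwartzMap.pairing (ContinuousLinearMap.mul ℂ ℂ) u w

/-- The tempered distribution `v` is the product `u w`: the Fourier transforms `û`, `ŵ` are
functions, their convolution converges absolutely almost everywhere, and
`v̂ = (2π)⁻² û ∗ ŵ`. -/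
def IsProduct (u w v : 𝓢'(Plane, ℂ)) : Prop :=
  ∃ F G : Plane → ℂ, HasFourierFunction u F ∧ HasFourierFunction w G ∧
    (∀ᵐ ζ : Plane, ConvolutionExistsAt F G ζ (ContinuousLinearMap.mul ℂ ℂ) volume) ∧
    HasFourierFunction v (fun ζ =>
      ((2 * Real.pi : ℝ) : ℂ)⁻¹ ^ 2 *
        convolution F G (ContinuousLinearMap.mul ℂ ℂ) volume ζ)

end

/-! ### The bracket -/

/-! On the Fourier side the claim is a weighted `L²` bound for `∫ |F(η)| |G(η - ζ)| dη` with `F =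
û`, `G = ŵ`. Moving the weights into one kernel and dualizing turns it into a trilinear estimate `∫∫
h(ζ) K(ζ, η) f(η) g(η - ζ) ≲ ‖h‖ ‖f‖ ‖g‖` in `L²`. By Cauchy–Schwarz such a form is bounded as soon
as `K²` has bounded integrals with one of `ζ`, `η`, `η - ζ` held fixed.

No single choice works for the whole kernel, so `kernel_le` dominates it by four simpler ones. With
`ζ = (ξ, τ)`, `η = (ξ₁, τ₁)` and modulations `λ₁ = τ₁ + ξ₁²/2`, `λ₂ = τ₁ - τ + (ξ₁ - ξ)²/2`,
everything rests on the resonance identity `λ₁ - λ₂ = τ + ξ (ξ₁ - ξ/2)`. For `|ξ| ≥ 1` the frequency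
weights are at most a multiple of `|ξ|^{1/2}` (if `k ≥ 0`, or after absorption by `⟨τ⟩^{-a}`), or
else the larger modulation absorbs them because `a < b`.

The kernel with `|ξ|^{1/2}` is square integrable in `η`, since `ξ₁ ↦ λ₁ - λ₂` has Jacobian `|ξ|`.
The two kernels that have lost a modulation are integrated along parabolas, which needs `a > 1/4`.
For `|ξ| < 1` the Jacobian degenerates; the modulations then control `|ξ| ⟨ξ₁⟩`, and what remains is
`|ξ|^{-2a}`, integrable near zero because `a < 1/2`.

For general distributions the same bound gives absolute convergence almost everywhere, and a
function with finite weighted `L²` norm is the transform of a tempered distribution. -/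

lemma one_le_bracket (x : ℝ) : 1 ≤ bracket x := by
  unfold bracket; linarith [abs_nonneg x]

lemma bracket_pos (x : ℝ) : 0 < bracket x := one_pos.trans_le (one_le_bracket x)

lemma bracket_neg (x : ℝ) : bracket (-x) = bracket x := by simp [bracket]

lemma bracket_add_le (x y : ℝ) : bracket (x + y) ≤ bracket x + bracket y := by
  unfold bracket; linarith [abs_add_le x y]

lemma bracket_add_le_mul (x y : ℝ) : bracket (x + y) ≤ bracket x * bracket y := by
  unfold bracket; nlinarith [abs_add_le x y, abs_nonneg x, abs_nonneg y]

@[fun_prop]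
lemma measurable_bracket : Measurable bracket := by
  unfold bracket
  exact measurable_const.add continuous_abs.measurable

lemma bracket_rpow_pos (x p : ℝ) : 0 < bracket x ^ p := Real.rpow_pos_of_pos (bracket_pos x) p

lemma bracket_rpow_le_one {p : ℝ} (hp : p ≤ 0) (x : ℝ) : bracket x ^ p ≤ 1 :=
  Real.rpow_le_one_of_one_le_of_nonpos (one_le_bracket x) hp

lemma bracket_rpow_le_rpow {p q : ℝ} (h : p ≤ q) (x : ℝ) : bracket x ^ p ≤ bracket x ^ q :=
  Real.rpow_le_rpow_of_exponent_le (one_le_bracket x) h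

lemma bracket_rpow_mul_neg (x p : ℝ) : bracket x ^ p * bracket x ^ (-p) = 1 := by
  rw [← Real.rpow_add (bracket_pos x)]; simp

/-! ### Pointwise domination of the kernel -/

/-- Below unit frequency the kernel is controlled by the weight of one of the factors. -/
lemma weight_le_of_abs_lt_one {k s a : ℝ} (hk : -2 * k ≤ a) (ha : 0 ≤ a) {ξ : ℝ} (hξ : |ξ| < 1)
    (ξ₁ : ℝ) :
    bracket ξ ^ s * bracket ξ₁ ^ (-k) * bracket (ξ₁ - ξ) ^ (-k) ≤
      2 ^ (|s| + |k|) * bracket ξ₁ ^ a := by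
  have h1 : bracket ξ ^ s ≤ 2 ^ |s| :=
    (bracket_rpow_le_rpow (le_abs_self s) ξ).trans
      (Real.rpow_le_rpow (bracket_pos _).le (by unfold bracket; linarith) (abs_nonneg s))
  have h2 : bracket ξ₁ ^ (-k) * bracket (ξ₁ - ξ) ^ (-k) ≤ 2 ^ |k| * bracket ξ₁ ^ a := by
    rcases le_total 0 k with hk0 | hk0
    · calc _ ≤ (1 : ℝ) * 1 := mul_le_mul (bracket_rpow_le_one (by linarith) _)
            (bracket_rpow_le_one (by linarith) _) (bracket_rpow_pos _ _).le zero_le_one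
        _ ≤ _ := mul_le_mul (Real.one_le_rpow one_le_two (abs_nonneg _))
            (Real.one_le_rpow (one_le_bracket _) ha) zero_le_one (by positivity)
    · have h3 : bracket (ξ₁ - ξ) ≤ 2 * bracket ξ₁ := by
        have := abs_sub ξ₁ ξ
        unfold bracket; linarith [abs_nonneg ξ₁]
      rw [abs_of_nonpos hk0]
      calc _ ≤ bracket ξ₁ ^ (-k) * (2 * bracket ξ₁) ^ (-k) := by
            gcongr
            · exact (bracket_rpow_pos _ _).le
            · exact (bracket_pos _).le
            · linarith
        _ = 2 ^ (-k) * bracket ξ₁ ^ (-2 * k) := by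
            rw [Real.mul_rpow zero_le_two (bracket_pos _).le, show -2 * k = -k + -k by ring,
              Real.rpow_add (bracket_pos _)]
            ring
        _ ≤ _ := by gcongr; exact one_le_bracket _
  calc _ = bracket ξ ^ s * (bracket ξ₁ ^ (-k) * bracket (ξ₁ - ξ) ^ (-k)) := by ring
    _ ≤ 2 ^ |s| * (2 ^ |k| * bracket ξ₁ ^ a) := by
        gcongr
        exact mul_nonneg (bracket_rpow_pos _ _).le (bracket_rpow_pos _ _).le
    _ = _ := by rw [Real.rpow_add two_pos]; ring

lemma bracket_rpow_le_abs_rpow_half {p ξ : ℝ} (hp : p ≤ 1 / 2) (hξ : 1 ≤ |ξ|) :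
    bracket ξ ^ p ≤ 2 * |ξ| ^ (1 / 2 : ℝ) := by
  calc _ ≤ bracket ξ ^ (1 / 2 : ℝ) := bracket_rpow_le_rpow hp ξ
    _ ≤ (2 ^ (2 : ℝ) * |ξ|) ^ (1 / 2 : ℝ) := by
        gcongr
        · exact (bracket_pos _).le
        · unfold bracket; norm_num; linarith
    _ = _ := by
        rw [Real.mul_rpow (by positivity) (by positivity), ← Real.rpow_mul zero_le_two]; norm_num

/-- The larger of the two input frequencies carries at least half of `⟨ξ⟩`, so its negative power
gains `⟨ξ⟩^{-k}`, the other power is at most one, and `s - k ≤ 1/2` remains. -/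
lemma weight_le_of_nonneg {k s : ℝ} (hk : 0 ≤ k) (hs : s ≤ k + 1 / 2) {ξ : ℝ} (hξ : 1 ≤ |ξ|)
    (ξ₁ : ℝ) :
    bracket ξ ^ s * bracket ξ₁ ^ (-k) * bracket (ξ₁ - ξ) ^ (-k) ≤
      2 ^ k * (2 * |ξ| ^ (1 / 2 : ℝ)) := by
  have key : ∀ x y : ℝ, bracket ξ ≤ 2 * bracket x →
      bracket x ^ (-k) * bracket y ^ (-k) ≤ 2 ^ k * bracket ξ ^ (-k) := by
    intro x y h
    calc bracket x ^ (-k) * bracket y ^ (-k) ≤ bracket x ^ (-k) * 1 := by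
          gcongr
          · exact (bracket_rpow_pos _ _).le
          · exact bracket_rpow_le_one (by linarith) _
      _ = 2 ^ k * (2 * bracket x) ^ (-k) := by
          rw [Real.mul_rpow zero_le_two (bracket_pos _).le, ← mul_assoc, ← Real.rpow_add two_pos]
          simp
      _ ≤ _ := by
          gcongr 2 ^ k * ?_
          exact Real.rpow_le_rpow_of_nonpos (bracket_pos _) h (by linarith)
  have h2 : bracket ξ₁ ^ (-k) * bracket (ξ₁ - ξ) ^ (-k) ≤ 2 ^ k * bracket ξ ^ (-k) := by
    have h := bracket_add_le ξ₁ (-(ξ₁ - ξ))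
    rw [bracket_neg, show ξ₁ + -(ξ₁ - ξ) = ξ by ring] at h
    rcases le_total (bracket ξ₁) (bracket (ξ₁ - ξ)) with h' | h'
    · rw [mul_comm]; exact key _ _ (by linarith)
    · exact key _ _ (by linarith)
  calc _ = bracket ξ ^ s * (bracket ξ₁ ^ (-k) * bracket (ξ₁ - ξ) ^ (-k)) := by ring
    _ ≤ bracket ξ ^ s * (2 ^ k * bracket ξ ^ (-k)) := by
        gcongr
        exact (bracket_rpow_pos _ _).le
    _ = 2 ^ k * bracket ξ ^ (s - k) := by
        rw [sub_eq_add_neg, Real.rpow_add (bracket_pos _)]; ring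
    _ ≤ _ := by
        gcongr
        exact bracket_rpow_le_abs_rpow_half (by linarith) hξ

/-- Both input frequencies are `(ξ₁ - ξ/2) ± ξ/2`, so each bracket is at most `⟨ξ₁ - ξ/2⟩ ⟨ξ⟩`. The
bound is phrased in `ξ₁ - ξ/2` because this is what the resonance identity multiplies by `ξ`. -/
lemma weight_le_of_nonpos {k s a : ℝ} (hk : k ≤ 0) (hka : -2 * k ≤ a) (hsa : s - 2 * k ≤ a)
    (ξ ξ₁ : ℝ) :
    bracket ξ ^ s * bracket ξ₁ ^ (-k) * bracket (ξ₁ - ξ) ^ (-k) ≤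
      bracket ξ ^ a * bracket (ξ₁ - ξ / 2) ^ a := by
  have hh : bracket (ξ / 2) ≤ bracket ξ := by
    unfold bracket; rw [abs_div, abs_two]; linarith [abs_nonneg ξ]
  have h1 : bracket ξ₁ ≤ bracket (ξ₁ - ξ / 2) * bracket ξ := by
    have := bracket_add_le_mul (ξ₁ - ξ / 2) (ξ / 2)
    rw [sub_add_cancel] at this
    exact this.trans (mul_le_mul_of_nonneg_left hh (bracket_pos _).le)
  have h2 : bracket (ξ₁ - ξ) ≤ bracket (ξ₁ - ξ / 2) * bracket ξ := by
    have := bracket_add_le_mul (ξ₁ - ξ / 2) (-(ξ / 2))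
    rw [bracket_neg, show ξ₁ - ξ / 2 + -(ξ / 2) = ξ₁ - ξ by ring] at this
    exact this.trans (mul_le_mul_of_nonneg_left hh (bracket_pos _).le)
  set X := bracket ξ
  set Y := bracket (ξ₁ - ξ / 2)
  have hX : 0 < X := bracket_pos _
  have hY : 0 < Y := bracket_pos _
  calc _ = X ^ s * (bracket ξ₁ ^ (-k) * bracket (ξ₁ - ξ) ^ (-k)) := by ring
    _ ≤ X ^ s * ((Y * X) ^ (-k) * (Y * X) ^ (-k)) := by
        gcongr
        · exact (bracket_rpow_pos _ _).le
        · exact (bracket_pos _).le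
        · linarith
        · exact (bracket_pos _).le
        · linarith
    _ = X ^ (s - 2 * k) * Y ^ (-2 * k) := by
        rw [Real.mul_rpow hY.le hX.le, show s - 2 * k = s + -k + -k by ring,
          show -2 * k = -k + -k by ring, Real.rpow_add hX, Real.rpow_add hX, Real.rpow_add hY]
        ring
    _ ≤ _ := by
        gcongr
        · exact one_le_bracket _
        · exact one_le_bracket _

/-- The resonance identity `λ₁ - λ₂ = τ + ξ (ξ₁ - ξ / 2)` for the modulations `λ₁`, `λ₂` of the
two factors: if the bracket of `ξ₁ - ξ / 2` dominates that of `τ`, one modulation is large. -/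
lemma bracket_mul_bracket_le_modulation {ξ τ ξ₁ τ₁ : ℝ} (hξ : 1 ≤ |ξ|)
    (hy : 2 * bracket τ < bracket (ξ₁ - ξ / 2)) :
    bracket ξ * bracket (ξ₁ - ξ / 2) ≤
      16 * max (bracket (τ₁ + ξ₁ ^ 2 / 2)) (bracket (τ₁ - τ + (ξ₁ - ξ) ^ 2 / 2)) := by
  set y := ξ₁ - ξ / 2 with hydef
  set l₁ := τ₁ + ξ₁ ^ 2 / 2 with hl₁
  set l₂ := τ₁ - τ + (ξ₁ - ξ) ^ 2 / 2 with hl₂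
  have hid : ξ * y = l₁ - l₂ - τ := by rw [hydef, hl₁, hl₂]; ring
  have h1 : |ξ| * |y| ≤ |l₁| + |l₂| + |τ| := by
    rw [← abs_mul, hid]
    have := abs_sub (l₁ - l₂) τ
    have := abs_sub l₁ l₂
    linarith
  -- As `2|τ| < |y| ≤ |ξ||y|`, the term `|τ|` is absorbed: `|ξ||y| ≤ 2(|l₁| + |l₂|)`, at most four
  -- times the maximum. Replacing absolute values by brackets on the left costs another 4, hence 16.
  have hy' : 1 + 2 * |τ| < |y| := by unfold bracket at hy; linarith
  have h3 : |y| ≤ |ξ| * |y| := le_mul_of_one_le_left (abs_nonneg _) hξ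
  have h4 : |l₁| + |l₂| ≤ 2 * max (bracket l₁) (bracket l₂) := by
    have := le_max_left (bracket l₁) (bracket l₂)
    have := le_max_right (bracket l₁) (bracket l₂)
    unfold bracket at *
    linarith
  have h5 : bracket ξ * bracket y ≤ 4 * (|ξ| * |y|) := by
    have : 1 ≤ |y| := by linarith [abs_nonneg τ]
    unfold bracket
    nlinarith
  linarith [abs_nonneg τ]

/-- The four kernels that dominate the kernel of the bilinear form: they are bounded by integrating
in the first factor, in the output (twice), and in the second factor. -/
theorem kernel_le {k s a b : ℝ} (hs : s ≤ k + 1 / 2) (hb : 1 / 2 < b)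
    (ha : max (1 / 4) (max 0 s - 2 * k) < a) (ha' : a < 1 / 2) :
    ∃ C : ℝ, 0 < C ∧ ∀ ξ τ ξ₁ τ₁ : ℝ,
      bracket ξ ^ s * bracket τ ^ (-a) * (bracket ξ₁ ^ (-k) * bracket (τ₁ + ξ₁ ^ 2 / 2) ^ (-b)) *
        (bracket (ξ₁ - ξ) ^ (-k) * bracket (τ₁ - τ + (ξ₁ - ξ) ^ 2 / 2) ^ (-b)) ≤
      C * (|ξ| ^ (1 / 2 : ℝ) *
            (bracket (τ₁ + ξ₁ ^ 2 / 2) ^ (-b) * bracket (τ₁ - τ + (ξ₁ - ξ) ^ 2 / 2) ^ (-b)) +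
          (if |ξ| < 1 then 1 else 0) * (bracket ξ₁ ^ a * (bracket τ ^ (-a) *
            (bracket (τ₁ + ξ₁ ^ 2 / 2) ^ (-b) * bracket (τ₁ - τ + (ξ₁ - ξ) ^ 2 / 2) ^ (-b)))) +
          bracket τ ^ (-a) * bracket (τ₁ - τ + (ξ₁ - ξ) ^ 2 / 2) ^ (-b) +
          bracket τ ^ (-a) * bracket (τ₁ + ξ₁ ^ 2 / 2) ^ (-b)) := by
  obtain ⟨ha4, has⟩ := max_lt_iff.1 ha
  have has0 : -2 * k < a := by linarith [le_max_left 0 s]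
  have hass : s - 2 * k < a := by linarith [le_max_right 0 s]
  have ha0 : 0 < a := by linarith
  -- One summand per regime: `|ξ| < 1`; `|ξ| ≥ 1` with `k ≥ 0`; `k ≤ 0` with `⟨ξ₁ - ξ/2⟩ ≤ 2⟨τ⟩`; `k
  -- ≤ 0` with one large modulation.
  refine ⟨2 ^ (|s| + |k|) + 2 ^ |k| * 2 + 2 ^ a * 2 + 16 ^ a, by positivity, ?_⟩
  intro ξ τ ξ₁ τ₁
  set D₁ : ℝ := 2 ^ (|s| + |k|)
  set D₂ : ℝ := 2 ^ |k| * 2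
  set D₃ : ℝ := 2 ^ a * 2
  set D₄ : ℝ := 16 ^ a
  have hD₁ : 0 < D₁ := by positivity
  have hD₂ : 0 < D₂ := by positivity
  have hD₃ : 0 < D₃ := by positivity
  have hD₄ : 0 < D₄ := by positivity
  set σ₁ := bracket (τ₁ + ξ₁ ^ 2 / 2) with hσ₁
  set σ₂ := bracket (τ₁ - τ + (ξ₁ - ξ) ^ 2 / 2) with hσ₂
  have p₁ : 0 < σ₁ ^ (-b) := bracket_rpow_pos _ _
  have p₂ : 0 < σ₂ ^ (-b) := bracket_rpow_pos _ _
  have pτ : 0 < bracket τ ^ (-a) := bracket_rpow_pos _ _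
  have pa : 0 < bracket ξ₁ ^ a := bracket_rpow_pos _ _
  have pξ : 0 ≤ |ξ| ^ (1 / 2 : ℝ) := by positivity
  have pW : 0 ≤ bracket ξ ^ s * bracket ξ₁ ^ (-k) * bracket (ξ₁ - ξ) ^ (-k) :=
    mul_nonneg (mul_nonneg (bracket_rpow_pos _ _).le (bracket_rpow_pos _ _).le)
      (bracket_rpow_pos _ _).le
  rw [show bracket ξ ^ s * bracket τ ^ (-a) * (bracket ξ₁ ^ (-k) * σ₁ ^ (-b)) *
      (bracket (ξ₁ - ξ) ^ (-k) * σ₂ ^ (-b)) =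
      (bracket ξ ^ s * bracket ξ₁ ^ (-k) * bracket (ξ₁ - ξ) ^ (-k)) *
        (bracket τ ^ (-a) * (σ₁ ^ (-b) * σ₂ ^ (-b))) by ring]
  set W := bracket ξ ^ s * bracket ξ₁ ^ (-k) * bracket (ξ₁ - ξ) ^ (-k)
  have pp : 0 < σ₁ ^ (-b) * σ₂ ^ (-b) := mul_pos p₁ p₂
  have t1 : 0 ≤ |ξ| ^ (1 / 2 : ℝ) * (σ₁ ^ (-b) * σ₂ ^ (-b)) := by positivity
  have t3 : 0 < bracket τ ^ (-a) * σ₂ ^ (-b) := by positivity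
  have t4 : 0 < bracket τ ^ (-a) * σ₁ ^ (-b) := by positivity
  have hτ1 : bracket τ ^ (-a) ≤ 1 := bracket_rpow_le_one (by linarith) τ
  by_cases hξ : |ξ| < 1
  · rw [if_pos hξ, one_mul]
    have t2 : 0 < bracket ξ₁ ^ a * (bracket τ ^ (-a) * (σ₁ ^ (-b) * σ₂ ^ (-b))) := by positivity
    calc W * (bracket τ ^ (-a) * (σ₁ ^ (-b) * σ₂ ^ (-b)))
        ≤ (D₁ * bracket ξ₁ ^ a) * (bracket τ ^ (-a) * (σ₁ ^ (-b) * σ₂ ^ (-b))) := by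
          gcongr
          exact weight_le_of_abs_lt_one has0.le ha0.le hξ ξ₁
      _ = D₁ * (bracket ξ₁ ^ a * (bracket τ ^ (-a) * (σ₁ ^ (-b) * σ₂ ^ (-b)))) := by ring
      _ ≤ _ := mul_le_mul (by linarith) (by linarith) t2.le (by linarith)
  rw [if_neg hξ, zero_mul]
  push Not at hξ
  -- Regimes in which the frequency weights cost at most `|ξ|^{1/2}`; the first kernel suffices.
  have caseA : ∀ D : ℝ, 0 < D → D ≤ D₁ + D₂ + D₃ + D₄ →
      W * bracket τ ^ (-a) ≤ D * |ξ| ^ (1 / 2 : ℝ) →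
      W * (bracket τ ^ (-a) * (σ₁ ^ (-b) * σ₂ ^ (-b))) ≤ (D₁ + D₂ + D₃ + D₄) *
        (|ξ| ^ (1 / 2 : ℝ) * (σ₁ ^ (-b) * σ₂ ^ (-b)) + 0 + bracket τ ^ (-a) * σ₂ ^ (-b) +
          bracket τ ^ (-a) * σ₁ ^ (-b)) := by
    intro D hD hDle h
    calc _ = W * bracket τ ^ (-a) * (σ₁ ^ (-b) * σ₂ ^ (-b)) := by ring
      _ ≤ D * |ξ| ^ (1 / 2 : ℝ) * (σ₁ ^ (-b) * σ₂ ^ (-b)) := by gcongr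
      _ = D * (|ξ| ^ (1 / 2 : ℝ) * (σ₁ ^ (-b) * σ₂ ^ (-b))) := by ring
      _ ≤ _ := mul_le_mul hDle (by linarith) t1 (by linarith)
  rcases le_total 0 k with hk | hk
  · refine caseA D₂ hD₂ (by linarith) ?_
    calc W * bracket τ ^ (-a) ≤ W * 1 := by gcongr
      _ = W := mul_one W
      _ ≤ 2 ^ k * (2 * |ξ| ^ (1 / 2 : ℝ)) := weight_le_of_nonneg hk hs hξ ξ₁
      _ = D₂ * |ξ| ^ (1 / 2 : ℝ) := by simp only [D₂, abs_of_nonneg hk]; ring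
  have hW := weight_le_of_nonpos hk has0.le hass.le ξ ξ₁
  rcases le_or_gt (bracket (ξ₁ - ξ / 2)) (2 * bracket τ) with hy | hy
  · refine caseA D₃ hD₃ (by linarith) ?_
    calc W * bracket τ ^ (-a)
        ≤ bracket ξ ^ a * bracket (ξ₁ - ξ / 2) ^ a * bracket τ ^ (-a) := by gcongr
      _ ≤ bracket ξ ^ a * (2 * bracket τ) ^ a * bracket τ ^ (-a) := by
          gcongr
          · exact (bracket_rpow_pos _ _).le
          · exact (bracket_pos _).le
      _ = 2 ^ a * bracket ξ ^ a * (bracket τ ^ a * bracket τ ^ (-a)) := by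
          rw [Real.mul_rpow zero_le_two (bracket_pos _).le]; ring
      _ = 2 ^ a * bracket ξ ^ a := by rw [bracket_rpow_mul_neg, mul_one]
      _ ≤ 2 ^ a * (2 * |ξ| ^ (1 / 2 : ℝ)) := by
          gcongr
          exact bracket_rpow_le_abs_rpow_half ha'.le hξ
      _ = _ := by ring
  have hmod := bracket_mul_bracket_le_modulation (τ₁ := τ₁) hξ hy
  -- In the resonant regime the larger modulation bounds the weights by its `a`-th power, which its
  -- own `-b`-th power absorbs. The other modulation survives, giving one of the last two kernels.
  have caseB : ∀ x : ℝ, bracket ξ * bracket (ξ₁ - ξ / 2) ≤ 16 * bracket x →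
      W * bracket x ^ (-b) ≤ D₄ := by
    intro x hx
    calc W * bracket x ^ (-b) ≤ (16 * bracket x) ^ a * bracket x ^ (-b) := by
          gcongr
          · exact (bracket_rpow_pos _ _).le
          · refine hW.trans ?_
            rw [← Real.mul_rpow (bracket_pos _).le (bracket_pos _).le]
            exact Real.rpow_le_rpow (mul_nonneg (bracket_pos _).le (bracket_pos _).le) hx ha0.le
      _ = D₄ * bracket x ^ (a - b) := by
          rw [Real.mul_rpow (by norm_num) (bracket_pos _).le, sub_eq_add_neg,
            Real.rpow_add (bracket_pos _)]
          ring
      _ ≤ D₄ * 1 := by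
          gcongr
          exact bracket_rpow_le_one (by linarith) _
      _ = D₄ := mul_one _
  rcases le_total σ₁ σ₂ with h | h
  · rw [← hσ₁, ← hσ₂, max_eq_right h] at hmod
    calc _ = W * σ₂ ^ (-b) * (bracket τ ^ (-a) * σ₁ ^ (-b)) := by ring
      _ ≤ D₄ * (bracket τ ^ (-a) * σ₁ ^ (-b)) := by
          gcongr
          exact caseB _ hmod
      _ ≤ _ := mul_le_mul (by linarith) (by linarith) t4.le (by linarith)
  · rw [← hσ₁, ← hσ₂, max_eq_left h] at hmod
    calc _ = W * σ₁ ^ (-b) * (bracket τ ^ (-a) * σ₂ ^ (-b)) := by ring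
      _ ≤ D₄ * (bracket τ ^ (-a) * σ₂ ^ (-b)) := by
          gcongr
          exact caseB _ hmod
      _ ≤ _ := mul_le_mul (by linarith) (by linarith) t3.le (by linarith)

/-! ### One-dimensional integrals of powers of the bracket -/

/-- The power `⟨x⟩ ^ p` as an extended nonnegative real. -/
noncomputable def bracketPow (p x : ℝ) : ℝ≥0∞ := ENNReal.ofReal (bracket x ^ p)

@[fun_prop]
lemma measurable_bracketPow (p : ℝ) : Measurable (bracketPow p) :=
  ENNReal.measurable_ofReal.comp (measurable_bracket.pow_const p)

lemma bracketPow_mul (p q x : ℝ) : bracketPow p x * bracketPow q x = bracketPow (p + q) x := by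
  unfold bracketPow
  rw [← ENNReal.ofReal_mul (bracket_rpow_pos _ _).le, Real.rpow_add (bracket_pos _)]

lemma bracketPow_neg_arg (p x : ℝ) : bracketPow p (-x) = bracketPow p x := by
  rw [bracketPow, bracket_neg, bracketPow]

lemma lintegral_bracketPow_lt_top {q : ℝ} (hq : 1 < q) : ∫⁻ x, bracketPow (-q) x < ∞ := by
  have := finite_integral_one_add_norm (E := ℝ) (μ := volume) (r := q) (by simpa using hq)
  simpa [bracketPow, bracket] using this

/-- One of `x`, `c - x` carries at least half of `⟨c⟩` and supplies `⟨c⟩^{-p}`. If it is `c - x`,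
its leftover exponent `-(q - p)` is transferred to the smaller bracket `⟨x⟩`, completing `⟨x⟩^{-q}`.
-/
lemma bracket_rpow_mul_sub_le {p q : ℝ} (hp : 0 ≤ p) (hpq : p ≤ q) (c x : ℝ) :
    bracket x ^ (-p) * bracket (c - x) ^ (-q) ≤
      2 ^ p * bracket c ^ (-p) * (bracket (c - x) ^ (-q) + bracket x ^ (-q)) := by
  have hc : bracket c ≤ bracket x + bracket (c - x) := by
    simpa using bracket_add_le x (c - x)
  have key : ∀ y, bracket c ≤ 2 * bracket y → bracket y ^ (-p) ≤ 2 ^ p * bracket c ^ (-p) := by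
    intro y hy
    calc bracket y ^ (-p) = 2 ^ p * (2 * bracket y) ^ (-p) := by
          rw [Real.mul_rpow zero_le_two (bracket_pos _).le, ← mul_assoc, ← Real.rpow_add two_pos]
          simp
      _ ≤ _ := by
          gcongr 2 ^ p * ?_
          exact Real.rpow_le_rpow_of_nonpos (bracket_pos _) hy (by linarith)
  have pc := bracket_rpow_pos c (-p)
  have p1 := bracket_rpow_pos x (-q)
  have p2 := bracket_rpow_pos (c - x) (-q)
  rcases le_total (bracket (c - x)) (bracket x) with h | h
  · calc _ ≤ 2 ^ p * bracket c ^ (-p) * bracket (c - x) ^ (-q) := by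
          gcongr
          exact key x (by linarith)
      _ ≤ _ := by gcongr; linarith
  · calc _ = bracket (c - x) ^ (-p) * (bracket (c - x) ^ (-(q - p)) * bracket x ^ (-p)) := by
          rw [show -q = -p + -(q - p) by ring, Real.rpow_add (bracket_pos _)]; ring
      _ ≤ 2 ^ p * bracket c ^ (-p) * (bracket x ^ (-(q - p)) * bracket x ^ (-p)) := by
          have hx := (bracket_rpow_pos x (-p)).le
          exact mul_le_mul (key _ (by linarith)) (mul_le_mul_of_nonneg_right
            (Real.rpow_le_rpow_of_nonpos (bracket_pos _) h (by linarith)) hx)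
            (mul_nonneg (bracket_rpow_pos _ _).le hx) (by positivity)
      _ = 2 ^ p * bracket c ^ (-p) * bracket x ^ (-q) := by
          rw [← Real.rpow_add (bracket_pos _)]; congr 2; ring
      _ ≤ _ := by gcongr; linarith

/-- `∫ ⟨x⟩^{-p} ⟨c - x⟩^{-q} dx ≲ ⟨c⟩^{-p}` for `0 ≤ p ≤ q`, `1 < q`. -/
lemma lintegral_bracketPow_mul_sub_le {p q : ℝ} (hp : 0 ≤ p) (hpq : p ≤ q) (hq : 1 < q) :
    ∃ C : ℝ≥0∞, C ≠ ∞ ∧ ∀ c, ∫⁻ x, bracketPow (-p) x * bracketPow (-q) (c - x) ≤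
      C * bracketPow (-p) c := by
  have hI := (lintegral_bracketPow_lt_top hq).ne
  set I := ∫⁻ x, bracketPow (-q) x with hIdef
  refine ⟨ENNReal.ofReal (2 ^ p) * (I + I), by finiteness, fun c => ?_⟩
  calc ∫⁻ x, bracketPow (-p) x * bracketPow (-q) (c - x)
      ≤ ∫⁻ x, ENNReal.ofReal (2 ^ p) * bracketPow (-p) c *
          (bracketPow (-q) (c - x) + bracketPow (-q) x) := by
        refine lintegral_mono fun x => ?_
        have p1 := bracket_rpow_pos x (-q)
        have p2 := bracket_rpow_pos (c - x) (-q)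
        have pc := bracket_rpow_pos c (-p)
        unfold bracketPow
        rw [← ENNReal.ofReal_mul (bracket_rpow_pos _ _).le, ← ENNReal.ofReal_mul (by positivity),
          ← ENNReal.ofReal_add p2.le p1.le, ← ENNReal.ofReal_mul (by positivity)]
        exact ENNReal.ofReal_le_ofReal (bracket_rpow_mul_sub_le hp hpq c x)
    _ = ENNReal.ofReal (2 ^ p) * bracketPow (-p) c * (I + I) := by
        rw [lintegral_const_mul _ (by fun_prop), lintegral_add_left (by fun_prop),
          lintegral_sub_left_eq_self (fun x => bracketPow (-q) x) c]
    _ = _ := by ring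

/-- For `t ≤ 0` the quadratic factors over its roots `±√(-2t)`, and the product dominates the square
of the distance to the nearer root. For `t ≥ 0` the square root is zero by convention and `x²/2 ≤ t
+ x²/2`. -/
lemma bracket_sq_le_of_parabola (t x : ℝ) :
    bracket (x - √(-2 * t)) ^ 2 ≤ 4 * bracket (t + x ^ 2 / 2) ∨
      bracket (x + √(-2 * t)) ^ 2 ≤ 4 * bracket (t + x ^ 2 / 2) := by
  have hb : ∀ y z : ℝ, y ^ 2 / 2 ≤ |z| → bracket y ^ 2 ≤ 4 * bracket z := by
    intro y z h
    unfold bracket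
    nlinarith [sq_abs y, sq_nonneg (|y| - 1)]
  set m := √(-2 * t) with hm
  have hm0 : 0 ≤ m := Real.sqrt_nonneg _
  rcases le_total t 0 with ht | ht
  · have hmt : t = -m ^ 2 / 2 := by rw [hm, Real.sq_sqrt (by linarith)]; ring
    have hz : t + x ^ 2 / 2 = (x - m) * (x + m) / 2 := by rw [hmt]; ring
    have hz' : |t + x ^ 2 / 2| = |x - m| * |x + m| / 2 := by
      rw [hz, abs_div, abs_mul, abs_two]
    rcases le_total 0 x with hx | hx
    · left
      apply hb
      rw [hz', ← sq_abs, sq]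
      have : |x - m| ≤ |x + m| := by
        rw [abs_of_nonneg (add_nonneg hx hm0)]
        exact abs_le.2 ⟨by linarith, by linarith⟩
      have := mul_le_mul_of_nonneg_left this (abs_nonneg (x - m))
      linarith
    · right
      apply hb
      rw [hz', ← sq_abs, sq]
      have : |x + m| ≤ |x - m| := by
        rw [abs_of_nonpos (by linarith : x - m ≤ 0)]
        exact abs_le.2 ⟨by linarith, by linarith⟩
      have := mul_le_mul_of_nonneg_right this (abs_nonneg (x + m))
      linarith
  · left
    have : m = 0 := Real.sqrt_eq_zero_of_nonpos (by linarith)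
    rw [this, sub_zero]
    apply hb
    linarith [le_abs_self (t + x ^ 2 / 2)]

/-- Uniform integrability along parabolas: `sup_t ∫ ⟨t + x²/2⟩^{-p} dx < ∞` for `p > 1/2`. -/
lemma lintegral_bracketPow_parabola_le {p : ℝ} (hp : 1 / 2 < p) :
    ∃ C : ℝ≥0∞, C ≠ ∞ ∧ ∀ t, ∫⁻ x, bracketPow (-p) (t + x ^ 2 / 2) ≤ C := by
  have hI := (lintegral_bracketPow_lt_top (show 1 < 2 * p by linarith)).ne
  set I := ∫⁻ x, bracketPow (-(2 * p)) x with hIdef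
  refine ⟨ENNReal.ofReal (4 ^ p) * (I + I), by finiteness, fun t => ?_⟩
  have key : ∀ y z : ℝ, bracket y ^ 2 ≤ 4 * bracket z →
      bracketPow (-p) z ≤ ENNReal.ofReal (4 ^ p) * bracketPow (-(2 * p)) y := by
    intro y z h
    unfold bracketPow
    rw [← ENNReal.ofReal_mul (by positivity)]
    apply ENNReal.ofReal_le_ofReal
    calc bracket z ^ (-p) = 4 ^ p * (4 * bracket z) ^ (-p) := by
          rw [Real.mul_rpow (by norm_num) (bracket_pos _).le, ← mul_assoc,
            ← Real.rpow_add (by norm_num)]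
          simp
      _ ≤ 4 ^ p * (bracket y ^ 2) ^ (-p) := by
          gcongr 4 ^ p * ?_
          exact Real.rpow_le_rpow_of_nonpos (pow_pos (bracket_pos _) 2) h (by linarith)
      _ = _ := by
          rw [← Real.rpow_natCast, ← Real.rpow_mul (bracket_pos _).le]
          congr 2; push_cast; ring
  calc ∫⁻ x, bracketPow (-p) (t + x ^ 2 / 2)
      ≤ ∫⁻ x, ENNReal.ofReal (4 ^ p) * (bracketPow (-(2 * p)) (x - √(-2 * t)) +
          bracketPow (-(2 * p)) (x + √(-2 * t))) := by
        gcongr with x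
        rw [mul_add]
        rcases bracket_sq_le_of_parabola t x with h | h
        · exact (key _ _ h).trans le_self_add
        · exact (key _ _ h).trans le_add_self
    _ = _ := by
        rw [lintegral_const_mul _ (by fun_prop), lintegral_add_left (by fun_prop),
          lintegral_sub_right_eq_self (fun x => bracketPow (-(2 * p)) x),
          lintegral_add_right_eq_self (fun x => bracketPow (-(2 * p)) x)]

lemma lintegral_abs_rpow_unit_lt_top {p : ℝ} (hp : p < 1) :
    ∫⁻ x : ℝ, (if |x| < 1 then 1 else 0) * ENNReal.ofReal (|x| ^ (-p)) < ∞ := by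
  have h0 : IntegrableOn (fun x : ℝ => x ^ (-p)) (Set.Ioo 0 1) :=
    (intervalIntegral.integrableOn_Ioo_rpow_iff one_pos).2 (by linarith)
  have h1 := h0.lintegral_lt_top
  rw [← lintegral_indicator measurableSet_Ioo] at h1
  set g : ℝ → ℝ≥0∞ := (Set.Ioo 0 1).indicator fun x => ENNReal.ofReal (x ^ (-p)) with hg
  have hgm : Measurable g := Measurable.indicator (by fun_prop) measurableSet_Ioo
  calc _ ≤ ∫⁻ x, g x + g (-x) := by
        refine lintegral_mono_ae ?_
        filter_upwards [Measure.ae_ne volume (0 : ℝ)] with x hx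
        split_ifs with h
        · obtain ⟨hl, hr⟩ := abs_lt.1 h
          rcases lt_or_gt_of_ne hx with h' | h'
          · refine le_add_left ?_
            rw [hg, Set.indicator_of_mem (Set.mem_Ioo.2 ⟨by linarith, by linarith⟩), abs_of_neg h',
              one_mul]
          · refine le_add_right ?_
            rw [hg, Set.indicator_of_mem (Set.mem_Ioo.2 ⟨h', hr⟩), abs_of_pos h', one_mul]
        · simp
    _ = (∫⁻ x, g x) + ∫⁻ x, g x := by
        rw [lintegral_add_left hgm, lintegral_neg_eq_self g]
    _ < ∞ := ENNReal.add_lt_top.2 ⟨h1, h1⟩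

/-- A change of variable, with equality for `r ≠ 0`. Keeping `|r|` on the left makes the bound
uniform down to `r = 0`, where the left side vanishes. -/
lemma ofReal_abs_mul_lintegral_comp_le {f : ℝ → ℝ≥0∞} (hf : Measurable f) (r c : ℝ) :
    ENNReal.ofReal |r| * ∫⁻ x, f (c + r * x) ≤ ∫⁻ x, f x := by
  rcases eq_or_ne r 0 with rfl | hr
  · simp
  · rw [← lintegral_add_left_eq_self f c]
    conv_rhs => rw [← Real.smul_map_volume_mul_left hr]
    rw [lintegral_smul_measure, lintegral_map (by fun_prop) (by fun_prop)]
    rfl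

/-! ### Bilinear operators on `L²` with a kernel -/

section Bilinear

variable {α : Type*} [MeasurableSpace α] {μ : Measure α}

lemma lintegral_mul_le_rpow_half_mul_rpow_half {P Q : α → ℝ≥0∞} (hP : Measurable P)
    (hQ : Measurable Q) :
    ∫⁻ z, P z * Q z ∂μ ≤
      (∫⁻ z, P z ^ 2 ∂μ) ^ (1 / 2 : ℝ) * (∫⁻ z, Q z ^ 2 ∂μ) ^ (1 / 2 : ℝ) := by
  simpa using ENNReal.lintegral_mul_le_Lp_mul_Lq μ Real.HolderConjugate.two_two
    hP.aemeasurable hQ.aemeasurable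

/-- An `L²` bound by duality. -/
lemma lintegral_sq_le_of_forall_lintegral_mul_le [SigmaFinite μ] {T : α → ℝ≥0∞}
    (hT : Measurable T) {M : ℝ≥0∞}
    (h : ∀ f : α → ℝ≥0∞, Measurable f →
      ∫⁻ x, f x * T x ∂μ ≤ M * (∫⁻ x, f x ^ 2 ∂μ) ^ (1 / 2 : ℝ)) :
    (∫⁻ x, T x ^ 2 ∂μ) ^ (1 / 2 : ℝ) ≤ M := by
  -- Testing against `T` itself would require cancelling a possibly infinite norm. Truncation in
  -- height and to sets of finite measure makes the norm finite; monotone convergence removes it.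
  set f : ℕ → α → ℝ≥0∞ := fun n => (spanningSets μ n).indicator fun x => min (T x) n with hf
  have hfm : ∀ n, Measurable (f n) := fun n =>
    (hT.min measurable_const).indicator (measurableSet_spanningSets μ n)
  have hfT : ∀ n x, f n x ≤ T x := fun n x =>
    (Set.indicator_le_self' (fun _ _ => zero_le) x).trans (min_le_left _ _)
  have hbound : ∀ n, ∫⁻ x, f n x ^ 2 ∂μ ≤ M ^ 2 := by
    intro n
    set A := ∫⁻ x, f n x ^ 2 ∂μ with hA
    have hfin : A ≠ ∞ := by
      refine ne_of_lt (lt_of_le_of_lt (b := ∫⁻ x, (spanningSets μ n).indicator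
        (fun _ => (n : ℝ≥0∞) ^ 2) x ∂μ) (lintegral_mono fun x => ?_) ?_)
      · by_cases hx : x ∈ spanningSets μ n
        · simp only [hf, Set.indicator_of_mem hx]
          gcongr
          exact min_le_right _ _
        · simp [hf, hx]
      · rw [lintegral_indicator_const (measurableSet_spanningSets μ n)]
        exact ENNReal.mul_lt_top (by finiteness) (measure_spanningSets_lt_top μ n)
    have h1 : A ≤ M * A ^ (1 / 2 : ℝ) := by
      refine le_trans (lintegral_mono fun x => ?_) (h (f n) (hfm n))
      rw [sq]
      gcongr
      exact hfT n x
    rcases eq_or_ne A 0 with h0 | h0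
    · rw [h0]; exact zero_le
    have h2 : A = A ^ (1 / 2 : ℝ) * A ^ (1 / 2 : ℝ) := by
      rw [← ENNReal.rpow_add _ _ h0 hfin]; norm_num
    have h3 : A ^ (1 / 2 : ℝ) ≤ M := by
      have hne : A ^ (1 / 2 : ℝ) ≠ 0 := by simp [h0]
      have hnt : A ^ (1 / 2 : ℝ) ≠ ∞ := ENNReal.rpow_ne_top_of_nonneg (by norm_num) hfin
      rw [h2] at h1
      exact (ENNReal.mul_le_mul_iff_left hne hnt).1 (h2 ▸ h1)
    rw [h2, sq]
    gcongr
  have hmono : Monotone f := by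
    intro m n hmn x
    by_cases hx : x ∈ spanningSets μ m
    · simp only [hf, Set.indicator_of_mem hx, Set.indicator_of_mem (monotone_spanningSets μ hmn hx)]
      gcongr
    · simp [hf, hx]
  have hlim : ∀ x, Filter.Tendsto (fun n => f n x ^ 2) Filter.atTop (nhds (T x ^ 2)) := by
    intro x
    refine ((ENNReal.continuous_pow 2).tendsto _).comp ?_
    have h1 : Filter.Tendsto (fun n : ℕ => min (T x) (n : ℝ≥0∞)) Filter.atTop (nhds (T x)) := by
      simpa using (tendsto_const_nhds (x := T x)).min ENNReal.tendsto_nat_nhds_top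
    refine h1.congr' ?_
    have hx := mem_spanningSetsIndex μ x
    filter_upwards [Filter.eventually_ge_atTop (spanningSetsIndex μ x)] with n hn
    simp only [hf, Set.indicator_of_mem (monotone_spanningSets μ hn hx)]
  have hle : ∫⁻ x, T x ^ 2 ∂μ ≤ M ^ 2 := by
    refine le_of_tendsto' (lintegral_tendsto_of_tendsto_of_monotone
      (fun n => ((hfm n).pow_const 2).aemeasurable)
      (Filter.Eventually.of_forall fun x m n hmn => ?_) (Filter.Eventually.of_forall hlim)) hbound
    exact pow_le_pow_left₀ zero_le (hmono hmn x) 2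
  calc (∫⁻ x, T x ^ 2 ∂μ) ^ (1 / 2 : ℝ) ≤ (M ^ 2) ^ (1 / 2 : ℝ) := by gcongr
    _ = M := by rw [← ENNReal.rpow_natCast, ← ENNReal.rpow_mul]; norm_num

variable {G : Type*} [AddCommGroup G] [MeasurableSpace G] [MeasurableAdd₂ G] [MeasurableNeg G]
  {ν : Measure G} [SigmaFinite ν] [ν.IsAddLeftInvariant]
  {K : G → G → ℝ≥0∞} {M : ℝ≥0∞} {h f g : G → ℝ≥0∞}

lemma rpow_half_mul_mul (M A B D : ℝ≥0∞) :
    (M * A) ^ (1 / 2 : ℝ) * (B * D) ^ (1 / 2 : ℝ) =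
      M ^ (1 / 2 : ℝ) * (A ^ (1 / 2 : ℝ) * B ^ (1 / 2 : ℝ) * D ^ (1 / 2 : ℝ)) := by
  rw [ENNReal.mul_rpow_of_nonneg _ _ (by norm_num), ENNReal.mul_rpow_of_nonneg _ _ (by norm_num)]
  ring

/-- The trilinear form of a kernel whose squares have bounded integrals in the second variable. -/
lemma trilinear_le_of_lintegral_snd [ν.IsNegInvariant] (hK : Measurable (Function.uncurry K))
    (hh : Measurable h) (hf : Measurable f) (hg : Measurable g) (hM : ∀ x, ∫⁻ y, K x y ^ 2 ∂ν ≤ M) :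
    ∫⁻ x, h x * ∫⁻ y, K x y * (f y * g (y - x)) ∂ν ∂ν ≤
      M ^ (1 / 2 : ℝ) * ((∫⁻ x, h x ^ 2 ∂ν) ^ (1 / 2 : ℝ) * (∫⁻ x, f x ^ 2 ∂ν) ^ (1 / 2 : ℝ) *
        (∫⁻ x, g x ^ 2 ∂ν) ^ (1 / 2 : ℝ)) := by
  -- For Cauchy–Schwarz on the product space, `K` is grouped with the factor that is constant in the
  -- variable in which `K²` is integrated; the other two factors decouple by invariance of the
  -- measure.
  have e1 : ∫⁻ x, h x * ∫⁻ y, K x y * (f y * g (y - x)) ∂ν ∂ν =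
      ∫⁻ z : G × G, (Function.uncurry K z * h z.1) * (f z.2 * g (z.2 - z.1)) ∂(ν.prod ν) := by
    rw [lintegral_prod _ (by fun_prop)]
    refine lintegral_congr fun x => ?_
    rw [← lintegral_const_mul _ (by fun_prop)]
    refine lintegral_congr fun y => ?_
    simp only [Function.uncurry_apply_pair]
    ring
  rw [e1, ← rpow_half_mul_mul]
  refine (lintegral_mul_le_rpow_half_mul_rpow_half (by fun_prop) (by fun_prop)).trans ?_
  gcongr
  · rw [lintegral_prod _ (by fun_prop), ← lintegral_const_mul _ (by fun_prop)]
    refine lintegral_mono fun x => ?_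
    simp only [Function.uncurry_apply_pair, mul_pow]
    rw [lintegral_mul_const _ (by fun_prop)]
    gcongr
    exact hM x
  · rw [lintegral_prod_symm _ (by fun_prop), ← lintegral_mul_const _ (by fun_prop)]
    refine lintegral_mono fun y => le_of_eq ?_
    simp only [mul_pow]
    rw [lintegral_const_mul _ (by fun_prop), lintegral_sub_left_eq_self (fun x => g x ^ 2) y]

/-- The trilinear form of a kernel whose squares have bounded integrals in the first variable. -/
lemma trilinear_le_of_lintegral_fst (hK : Measurable (Function.uncurry K)) (hh : Measurable h)
    (hf : Measurable f) (hg : Measurable g) (hM : ∀ y, ∫⁻ x, K x y ^ 2 ∂ν ≤ M) :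
    ∫⁻ x, h x * ∫⁻ y, K x y * (f y * g (y - x)) ∂ν ∂ν ≤
      M ^ (1 / 2 : ℝ) * ((∫⁻ x, h x ^ 2 ∂ν) ^ (1 / 2 : ℝ) * (∫⁻ x, f x ^ 2 ∂ν) ^ (1 / 2 : ℝ) *
        (∫⁻ x, g x ^ 2 ∂ν) ^ (1 / 2 : ℝ)) := by
  have e1 : ∫⁻ x, h x * ∫⁻ y, K x y * (f y * g (y - x)) ∂ν ∂ν =
      ∫⁻ z : G × G, (Function.uncurry K z * f z.2) * (h z.1 * g (z.2 - z.1)) ∂(ν.prod ν) := by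
    rw [lintegral_prod _ (by fun_prop)]
    refine lintegral_congr fun x => ?_
    rw [← lintegral_const_mul _ (by fun_prop)]
    refine lintegral_congr fun y => ?_
    simp only [Function.uncurry_apply_pair]
    ring
  rw [e1, mul_comm ((∫⁻ x, h x ^ 2 ∂ν) ^ (1 / 2 : ℝ)), ← rpow_half_mul_mul]
  refine (lintegral_mul_le_rpow_half_mul_rpow_half (by fun_prop) (by fun_prop)).trans ?_
  gcongr
  · rw [lintegral_prod_symm _ (by fun_prop), ← lintegral_const_mul _ (by fun_prop)]
    refine lintegral_mono fun x => ?_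
    simp only [Function.uncurry_apply_pair, mul_pow]
    rw [lintegral_mul_const _ (by fun_prop)]
    gcongr
    exact hM x
  · rw [lintegral_prod _ (by fun_prop), ← lintegral_mul_const _ (by fun_prop)]
    refine lintegral_mono fun x => le_of_eq ?_
    simp only [mul_pow]
    rw [lintegral_const_mul _ (by fun_prop), lintegral_sub_right_eq_self (fun x => g x ^ 2) x]

/-- The trilinear form of a kernel whose squares have bounded integrals along the diagonals. -/
lemma trilinear_le_of_lintegral_diag (hK : Measurable (Function.uncurry K)) (hh : Measurable h)
    (hf : Measurable f) (hg : Measurable g) (hM : ∀ z, ∫⁻ x, K x (z + x) ^ 2 ∂ν ≤ M) :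
    ∫⁻ x, h x * ∫⁻ y, K x y * (f y * g (y - x)) ∂ν ∂ν ≤
      M ^ (1 / 2 : ℝ) * ((∫⁻ x, h x ^ 2 ∂ν) ^ (1 / 2 : ℝ) * (∫⁻ x, f x ^ 2 ∂ν) ^ (1 / 2 : ℝ) *
        (∫⁻ x, g x ^ 2 ∂ν) ^ (1 / 2 : ℝ)) := by
  have hK' : Measurable fun z : G × G => K z.1 (z.2 + z.1) :=
    hK.comp (g := Function.uncurry K) (measurable_fst.prodMk (measurable_snd.add measurable_fst))
  have e1 : ∫⁻ x, h x * ∫⁻ y, K x y * (f y * g (y - x)) ∂ν ∂ν =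
      ∫⁻ z : G × G, (K z.1 (z.2 + z.1) * g z.2) * (h z.1 * f (z.2 + z.1)) ∂(ν.prod ν) := by
    rw [lintegral_prod _ (by fun_prop)]
    refine lintegral_congr fun x => ?_
    rw [← lintegral_add_right_eq_self (fun y => K x y * (f y * g (y - x))) x,
      ← lintegral_const_mul _ (by fun_prop)]
    refine lintegral_congr fun y => ?_
    rw [add_sub_cancel_right]
    ring
  have e2 : ∀ A B D : ℝ≥0∞, A * B * D = D * A * B := fun A B D => by ring
  rw [e1, e2 ((∫⁻ x, h x ^ 2 ∂ν) ^ (1 / 2 : ℝ)), ← rpow_half_mul_mul]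
  refine (lintegral_mul_le_rpow_half_mul_rpow_half (by fun_prop) (by fun_prop)).trans ?_
  gcongr
  · rw [lintegral_prod_symm _ (by fun_prop), ← lintegral_const_mul _ (by fun_prop)]
    refine lintegral_mono fun x => ?_
    simp only [mul_pow]
    rw [lintegral_mul_const _ (by fun_prop)]
    gcongr
    exact hM x
  · rw [lintegral_prod _ (by fun_prop), ← lintegral_mul_const _ (by fun_prop)]
    refine lintegral_mono fun x => le_of_eq ?_
    simp only [mul_pow]
    rw [lintegral_const_mul _ (by fun_prop), lintegral_add_right_eq_self (fun x => f x ^ 2) x]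

end Bilinear

/-! ### The bilinear estimate on the Fourier side -/

lemma lintegral_plane {f : ℝ → ℝ → ℝ≥0∞} (hf : Measurable (Function.uncurry f)) :
    ∫⁻ ζ : Plane, f (ζ 0) (ζ 1) = ∫⁻ x, ∫⁻ y, f x y := by
  have h := (volume_preserving_finTwoArrow ℝ).comp (PiLp.volume_preserving_ofLp (Fin 2))
  have h2 := h.lintegral_comp hf
  rw [Measure.volume_eq_prod, lintegral_prod _ hf.aemeasurable] at h2
  exact h2

lemma bracketPow_sq (p x : ℝ) : bracketPow p x ^ 2 = bracketPow (2 * p) x := by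
  rw [sq, bracketPow_mul, two_mul]

/-- The integral in `y` leaves `⟨t + (x₀ - x)²/2⟩^{-2a}`, integrable along the parabola precisely
because `2a > 1/2`. -/
lemma lintegral_bracketPow_mul_modulation_le {a b : ℝ} (ha : 1 / 4 < a) (hab : a ≤ b)
    (hb : 1 / 2 < b) :
    ∃ C : ℝ≥0∞, C ≠ ∞ ∧ ∀ t x₀ : ℝ,
      ∫⁻ x, ∫⁻ y, bracketPow (-(2 * a)) y * bracketPow (-(2 * b)) (t - y + (x₀ - x) ^ 2 / 2) ≤
        C := by
  obtain ⟨C₁, hC₁, h₁⟩ := lintegral_bracketPow_mul_sub_le (p := 2 * a) (q := 2 * b)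
    (by linarith) (by linarith) (by linarith)
  obtain ⟨C₂, hC₂, h₂⟩ := lintegral_bracketPow_parabola_le (p := 2 * a) (by linarith)
  refine ⟨C₁ * C₂, by finiteness, fun t x₀ => ?_⟩
  calc _ ≤ ∫⁻ x, C₁ * bracketPow (-(2 * a)) (t + (x₀ - x) ^ 2 / 2) := by
        refine lintegral_mono fun x => le_trans (le_of_eq ?_) (h₁ _)
        refine lintegral_congr fun y => ?_
        rw [show t - y + (x₀ - x) ^ 2 / 2 = t + (x₀ - x) ^ 2 / 2 - y by ring]
    _ = C₁ * ∫⁻ x, bracketPow (-(2 * a)) (t + x ^ 2 / 2) := by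
        rw [lintegral_const_mul _ (by fun_prop),
          lintegral_sub_left_eq_self (fun x => bracketPow (-(2 * a)) (t + x ^ 2 / 2)) x₀]
    _ ≤ _ := by gcongr; exact h₂ t

/-- The integral in `y` leaves the bracket of the difference of the modulations, which is affine in
`x` with slope `ξ`; the factor `|ξ|` pays for the change of variable. -/
lemma lintegral_modulation_mul_modulation_le {b : ℝ} (hb : 1 / 2 < b) :
    ∃ C : ℝ≥0∞, C ≠ ∞ ∧ ∀ ξ τ : ℝ,
      ∫⁻ x, ∫⁻ y, ENNReal.ofReal |ξ| * (bracketPow (-(2 * b)) (y + x ^ 2 / 2) *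
        bracketPow (-(2 * b)) (y - τ + (x - ξ) ^ 2 / 2)) ≤ C := by
  obtain ⟨C₁, hC₁, h₁⟩ := lintegral_bracketPow_mul_sub_le (p := 2 * b) (q := 2 * b)
    (by linarith) le_rfl (by linarith)
  have hI := (lintegral_bracketPow_lt_top (show 1 < 2 * b by linarith)).ne
  refine ⟨C₁ * ∫⁻ x, bracketPow (-(2 * b)) x, by finiteness, fun ξ τ => ?_⟩
  calc _ ≤ ∫⁻ x, ENNReal.ofReal |ξ| *
          (C₁ * bracketPow (-(2 * b)) ((τ - ξ ^ 2 / 2) + ξ * x)) := by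
        refine lintegral_mono fun x => ?_
        rw [lintegral_const_mul _ (by fun_prop)]
        gcongr
        rw [← lintegral_add_right_eq_self _ (-(x ^ 2 / 2))]
        refine le_trans (le_of_eq (lintegral_congr fun y => ?_)) (h₁ _)
        rw [neg_add_cancel_right, ← bracketPow_neg_arg _ (_ - y)]
        congr 2
        ring
    _ = C₁ * (ENNReal.ofReal |ξ| *
          ∫⁻ x, bracketPow (-(2 * b)) ((τ - ξ ^ 2 / 2) + ξ * x)) := by
        rw [lintegral_const_mul _ (by fun_prop), lintegral_const_mul _ (by fun_prop)]
        ring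
    _ ≤ _ := by
        gcongr
        exact ofReal_abs_mul_lintegral_comp_le (by fun_prop) _ _

/-- The two modulation arguments differ by `ξ ξ₁ - ξ²/2`, so `|ξ| ⟨ξ₁⟩` is at most twice the product
of their brackets. -/
lemma bracketPow_low_frequency_le {a b : ℝ} (ha : 0 ≤ a) (hab : a ≤ b) {ξ : ℝ} (hξ : |ξ| < 1)
    (hξ0 : ξ ≠ 0) (ξ₁ τ₁ : ℝ) :
    bracketPow (2 * a) ξ₁ * (bracketPow (-(2 * b)) (τ₁ + ξ₁ ^ 2 / 2) *
      bracketPow (-(2 * a)) (τ₁ + (ξ₁ - ξ) ^ 2 / 2)) ≤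
      ENNReal.ofReal (2 ^ (2 * a)) * ENNReal.ofReal (|ξ| ^ (-(2 * a))) := by
  set A := τ₁ + ξ₁ ^ 2 / 2 with hA
  set B := τ₁ + (ξ₁ - ξ) ^ 2 / 2 with hB
  have hξ0' : 0 < |ξ| := abs_pos.2 hξ0
  have h1 : |ξ| * bracket ξ₁ ≤ 2 * bracket (A - B) := by
    have e : ξ * ξ₁ = (A - B) + ξ ^ 2 / 2 := by rw [hA, hB]; ring
    have h2 : |ξ| * |ξ₁| ≤ |A - B| + 1 / 2 := by
      rw [← abs_mul, e]
      refine (abs_add_le _ _).trans ?_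
      rw [abs_of_nonneg (by positivity : (0 : ℝ) ≤ ξ ^ 2 / 2)]
      nlinarith [sq_abs ξ]
    unfold bracket
    nlinarith [abs_nonneg (A - B)]
  have h3 : bracket (A - B) ≤ bracket A * bracket B := by
    rw [← bracket_neg B, sub_eq_add_neg]
    exact bracket_add_le_mul _ _
  have pA := bracket_pos A
  have pB := bracket_pos B
  have p1 := bracket_pos ξ₁
  have h4 : bracket ξ₁ ≤ 2 * |ξ|⁻¹ * (bracket A * bracket B) := by
    rw [mul_comm 2, mul_assoc, inv_mul_eq_div, le_div_iff₀ hξ0', mul_comm]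
    exact h1.trans (by linarith)
  unfold bracketPow
  rw [← ENNReal.ofReal_mul (by positivity), ← ENNReal.ofReal_mul (by positivity),
    ← ENNReal.ofReal_mul (by positivity)]
  apply ENNReal.ofReal_le_ofReal
  calc bracket ξ₁ ^ (2 * a) * (bracket A ^ (-(2 * b)) * bracket B ^ (-(2 * a)))
      ≤ (2 * |ξ|⁻¹ * (bracket A * bracket B)) ^ (2 * a) *
          (bracket A ^ (-(2 * a)) * bracket B ^ (-(2 * a))) := by
        gcongr
        exact one_le_bracket A
    _ = 2 ^ (2 * a) * |ξ| ^ (-(2 * a)) * ((bracket A ^ (2 * a) * bracket A ^ (-(2 * a))) *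
          (bracket B ^ (2 * a) * bracket B ^ (-(2 * a)))) := by
        rw [Real.mul_rpow (by positivity) (by positivity), Real.mul_rpow pA.le pB.le,
          Real.mul_rpow (by positivity) (by positivity), Real.inv_rpow (abs_nonneg _),
          ← Real.rpow_neg (abs_nonneg _)]
        ring
    _ = _ := by rw [bracket_rpow_mul_neg, bracket_rpow_mul_neg]; ring

/-- After the integral in `y`, the growth in `ξ₁` is traded for the singularity `|x|^{-2a}`,
integrable since `2a < 1`. -/
lemma lintegral_low_frequency_le {a b : ℝ} (ha : 0 ≤ a) (ha' : a < 1 / 2) (hb : 1 / 2 < b) :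
    ∃ C : ℝ≥0∞, C ≠ ∞ ∧ ∀ ξ₁ τ₁ : ℝ,
      ∫⁻ x, ∫⁻ y, (if |x| < 1 then 1 else 0) * (bracketPow (2 * a) ξ₁ * (bracketPow (-(2 * a)) y *
        (bracketPow (-(2 * b)) (τ₁ + ξ₁ ^ 2 / 2) *
          bracketPow (-(2 * b)) (τ₁ - y + (ξ₁ - x) ^ 2 / 2)))) ≤ C := by
  obtain ⟨C₁, hC₁, h₁⟩ := lintegral_bracketPow_mul_sub_le (p := 2 * a) (q := 2 * b)
    (by linarith) (by linarith) (by linarith)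
  have hI := (lintegral_abs_rpow_unit_lt_top (show 2 * a < 1 by linarith)).ne
  refine ⟨C₁ * (ENNReal.ofReal (2 ^ (2 * a)) * ∫⁻ x : ℝ, (if |x| < 1 then 1 else 0) *
    ENNReal.ofReal (|x| ^ (-(2 * a)))), by finiteness, fun ξ₁ τ₁ => ?_⟩
  rw [← lintegral_const_mul' _ _ (by finiteness), ← lintegral_const_mul' _ _ hC₁]
  refine lintegral_mono_ae ?_
  filter_upwards [Measure.ae_ne volume (0 : ℝ)] with x hx
  split_ifs with h
  · simp only [one_mul]
    calc _ = bracketPow (2 * a) ξ₁ * bracketPow (-(2 * b)) (τ₁ + ξ₁ ^ 2 / 2) *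
          ∫⁻ y, bracketPow (-(2 * a)) y *
            bracketPow (-(2 * b)) (τ₁ + (ξ₁ - x) ^ 2 / 2 - y) := by
          rw [← lintegral_const_mul _ (by fun_prop)]
          refine lintegral_congr fun y => ?_
          rw [show τ₁ - y + (ξ₁ - x) ^ 2 / 2 = τ₁ + (ξ₁ - x) ^ 2 / 2 - y by ring]
          ring
      _ ≤ bracketPow (2 * a) ξ₁ * bracketPow (-(2 * b)) (τ₁ + ξ₁ ^ 2 / 2) *
          (C₁ * bracketPow (-(2 * a)) (τ₁ + (ξ₁ - x) ^ 2 / 2)) := by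
          gcongr
          exact h₁ _
      _ = C₁ * (bracketPow (2 * a) ξ₁ * (bracketPow (-(2 * b)) (τ₁ + ξ₁ ^ 2 / 2) *
          bracketPow (-(2 * a)) (τ₁ + (ξ₁ - x) ^ 2 / 2))) := by ring
      _ ≤ _ := by
          gcongr C₁ * ?_
          exact bracketPow_low_frequency_le ha (ha'.trans hb).le h hx ξ₁ τ₁
  · simp

lemma lintegral_plane_le {f : Plane → ℝ≥0∞} {M : ℝ≥0∞} (g : ℝ → ℝ → ℝ≥0∞)
    (hg : Measurable (Function.uncurry g)) (h : ∀ ζ : Plane, f ζ = g (ζ 0) (ζ 1))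
    (hM : ∫⁻ x, ∫⁻ y, g x y ≤ M) : ∫⁻ ζ, f ζ ≤ M := by
  rw [lintegral_congr h, lintegral_plane hg]
  exact hM

lemma ofReal_abs_rpow_half_sq (x : ℝ) :
    ENNReal.ofReal (|x| ^ (1 / 2 : ℝ)) ^ 2 = ENNReal.ofReal |x| := by
  rw [← ENNReal.ofReal_pow (by positivity), ← Real.rpow_natCast, ← Real.rpow_mul (abs_nonneg x)]
  norm_num

/-- The kernel that governs the product `u w̄` on the Fourier side. -/
noncomputable def productKernel (k s a b : ℝ) (ζ η : Plane) : ℝ≥0∞ :=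
  ENNReal.ofReal (bracket (ζ 0) ^ s * bracket (ζ 1) ^ (-a) *
    (bracket (η 0) ^ (-k) * bracket (η 1 + η 0 ^ 2 / 2) ^ (-b)) *
    (bracket (η 0 - ζ 0) ^ (-k) * bracket (η 1 - ζ 1 + (η 0 - ζ 0) ^ 2 / 2) ^ (-b)))

lemma measurable_productKernel (k s a b : ℝ) :
    Measurable (Function.uncurry (productKernel k s a b)) := by
  unfold productKernel Function.uncurry
  refine ENNReal.measurable_ofReal.comp ?_
  fun_prop

theorem trilinear_productKernel_le {k s a b : ℝ} (hs : s ≤ k + 1 / 2) (hb : 1 / 2 < b)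
    (ha : max (1 / 4) (max 0 s - 2 * k) < a) (ha' : a < 1 / 2) :
    ∃ C : ℝ≥0∞, C ≠ ∞ ∧ ∀ h f g : Plane → ℝ≥0∞, Measurable h → Measurable f → Measurable g →
      ∫⁻ ζ, h ζ * ∫⁻ η, productKernel k s a b ζ η * (f η * g (η - ζ)) ≤
        C * ((∫⁻ ζ, h ζ ^ 2) ^ (1 / 2 : ℝ) * (∫⁻ ζ, f ζ ^ 2) ^ (1 / 2 : ℝ) *
          (∫⁻ ζ, g ζ ^ 2) ^ (1 / 2 : ℝ)) := by
  have ha4 : 1 / 4 < a := (max_lt_iff.1 ha).1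
  obtain ⟨C, hC, hker⟩ := kernel_le hs hb ha ha'
  obtain ⟨M₁, hM₁, h₁⟩ := lintegral_modulation_mul_modulation_le hb
  obtain ⟨M₂, hM₂, h₂⟩ := lintegral_low_frequency_le (by linarith : 0 ≤ a) ha' hb
  obtain ⟨M₃, hM₃, h₃⟩ := lintegral_bracketPow_mul_modulation_le ha4 (ha'.trans hb).le hb
  set K₁ : Plane → Plane → ℝ≥0∞ := fun ζ η => ENNReal.ofReal (|ζ 0| ^ (1 / 2 : ℝ)) *
    (bracketPow (-b) (η 1 + η 0 ^ 2 / 2) *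
      bracketPow (-b) (η 1 - ζ 1 + (η 0 - ζ 0) ^ 2 / 2)) with hK₁
  set K₂ : Plane → Plane → ℝ≥0∞ := fun ζ η => (if |ζ 0| < 1 then 1 else 0) *
    (bracketPow a (η 0) * (bracketPow (-a) (ζ 1) * (bracketPow (-b) (η 1 + η 0 ^ 2 / 2) *
      bracketPow (-b) (η 1 - ζ 1 + (η 0 - ζ 0) ^ 2 / 2)))) with hK₂
  set K₃ : Plane → Plane → ℝ≥0∞ := fun ζ η => bracketPow (-a) (ζ 1) *
    bracketPow (-b) (η 1 - ζ 1 + (η 0 - ζ 0) ^ 2 / 2) with hK₃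
  set K₄ : Plane → Plane → ℝ≥0∞ := fun ζ η => bracketPow (-a) (ζ 1) *
    bracketPow (-b) (η 1 + η 0 ^ 2 / 2) with hK₄
  have hind : Measurable fun x : ℝ => if |x| < 1 then (1 : ℝ≥0∞) else 0 :=
    Measurable.ite (measurableSet_lt (by fun_prop) measurable_const) measurable_const
      measurable_const
  have m₁ : Measurable (Function.uncurry K₁) := by
    simp only [hK₁, Function.uncurry_def]; fun_prop
  have m₂ : Measurable (Function.uncurry K₂) := by
    simp only [hK₂, Function.uncurry_def]
    refine Measurable.mul (hind.comp (g := fun x : ℝ => if |x| < 1 then (1 : ℝ≥0∞) else 0)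
      (f := fun z : Plane × Plane => z.1 0) (by fun_prop)) (by fun_prop)
  have m₃ : Measurable (Function.uncurry K₃) := by
    simp only [hK₃, Function.uncurry_def]; fun_prop
  have m₄ : Measurable (Function.uncurry K₄) := by
    simp only [hK₄, Function.uncurry_def]; fun_prop
  have b₁ : ∀ ζ, ∫⁻ η, K₁ ζ η ^ 2 ≤ M₁ := by
    intro ζ
    refine lintegral_plane_le (fun x y => ENNReal.ofReal |ζ 0| *
      (bracketPow (-(2 * b)) (y + x ^ 2 / 2) *
        bracketPow (-(2 * b)) (y - ζ 1 + (x - ζ 0) ^ 2 / 2)))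
      (by simp only [Function.uncurry_def]; fun_prop) (fun η => ?_) (h₁ (ζ 0) (ζ 1))
    simp only [hK₁, mul_pow, bracketPow_sq, ofReal_abs_rpow_half_sq, mul_neg]
  have b₂ : ∀ η, ∫⁻ ζ, K₂ ζ η ^ 2 ≤ M₂ := by
    intro η
    refine lintegral_plane_le (fun x y => (if |x| < 1 then 1 else 0) *
      (bracketPow (2 * a) (η 0) * (bracketPow (-(2 * a)) y *
        (bracketPow (-(2 * b)) (η 1 + η 0 ^ 2 / 2) *
          bracketPow (-(2 * b)) (η 1 - y + (η 0 - x) ^ 2 / 2)))))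
      ?_ (fun ζ => ?_) (h₂ (η 0) (η 1))
    · simp only [Function.uncurry_def]
      exact Measurable.mul (hind.comp measurable_fst) (by fun_prop)
    · simp only [hK₂, mul_pow, bracketPow_sq, mul_neg]
      split_ifs <;> simp
  have b₃ : ∀ η, ∫⁻ ζ, K₃ ζ η ^ 2 ≤ M₃ := by
    intro η
    refine lintegral_plane_le (fun x y => bracketPow (-(2 * a)) y *
      bracketPow (-(2 * b)) (η 1 - y + (η 0 - x) ^ 2 / 2))
      (by simp only [Function.uncurry_def]; fun_prop) (fun ζ => ?_) (h₃ (η 1) (η 0))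
    simp only [hK₃, mul_pow, bracketPow_sq, mul_neg]
  have b₄ : ∀ z, ∫⁻ ζ, K₄ ζ (z + ζ) ^ 2 ≤ M₃ := by
    intro z
    -- With `z = η - ζ` fixed, the remaining modulation is evaluated at `z + ζ`. Since the bracket
    -- is even, `ζ ↦ -ζ` turns the integral into the one already bounded for `K₃`.
    rw [← lintegral_neg_eq_self]
    refine lintegral_plane_le (fun x y => bracketPow (-(2 * a)) y *
      bracketPow (-(2 * b)) (z 1 - y + (z 0 - x) ^ 2 / 2))
      (by simp only [Function.uncurry_def]; fun_prop) (fun ζ => ?_) (h₃ (z 1) (z 0))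
    simp only [hK₄, mul_pow, bracketPow_sq, mul_neg, PiLp.sub_apply, PiLp.neg_apply,
      bracketPow_neg_arg, ← sub_eq_add_neg]
  have hle : ∀ ζ η, productKernel k s a b ζ η ≤
      ENNReal.ofReal C * (K₁ ζ η + K₂ ζ η + K₃ ζ η + K₄ ζ η) := by
    intro ζ η
    refine (ENNReal.ofReal_le_ofReal (hker (ζ 0) (ζ 1) (η 0) (η 1))).trans (le_of_eq ?_)
    have p := fun x q => (bracket_rpow_pos x q).le
    have hi : ENNReal.ofReal (if |ζ 0| < 1 then 1 else 0) = if |ζ 0| < 1 then 1 else 0 := by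
      split_ifs <;> simp
    have q₀ : (0 : ℝ) ≤ if |ζ 0| < 1 then 1 else 0 := by split_ifs <;> norm_num
    have q₁ := mul_nonneg (p (η 1 + η 0 ^ 2 / 2) (-b)) (p (η 1 - ζ 1 + (η 0 - ζ 0) ^ 2 / 2) (-b))
    have q₂ := mul_nonneg (p (η 0) a) (mul_nonneg (p (ζ 1) (-a)) q₁)
    have r₁ := mul_nonneg (Real.rpow_nonneg (abs_nonneg (ζ 0)) (1 / 2)) q₁
    have r₂ := mul_nonneg q₀ q₂
    have r₃ := mul_nonneg (p (ζ 1) (-a)) (p (η 1 - ζ 1 + (η 0 - ζ 0) ^ 2 / 2) (-b))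
    have r₄ := mul_nonneg (p (ζ 1) (-a)) (p (η 1 + η 0 ^ 2 / 2) (-b))
    rw [ENNReal.ofReal_mul hC.le, ENNReal.ofReal_add (add_nonneg (add_nonneg r₁ r₂) r₃) r₄,
      ENNReal.ofReal_add (add_nonneg r₁ r₂) r₃, ENNReal.ofReal_add r₁ r₂,
      ENNReal.ofReal_mul (Real.rpow_nonneg (abs_nonneg (ζ 0)) (1 / 2)), ENNReal.ofReal_mul q₀, hi,
      ENNReal.ofReal_mul (p (η 0) a), ENNReal.ofReal_mul (p (ζ 1) (-a)),
      ENNReal.ofReal_mul (p (ζ 1) (-a)), ENNReal.ofReal_mul (p (ζ 1) (-a)),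
      ENNReal.ofReal_mul (p (η 1 + η 0 ^ 2 / 2) (-b))]
    rfl
  refine ⟨ENNReal.ofReal C * (M₁ ^ (1 / 2 : ℝ) + M₂ ^ (1 / 2 : ℝ) + M₃ ^ (1 / 2 : ℝ) +
    M₃ ^ (1 / 2 : ℝ)), by finiteness, fun h f g hh hf hg => ?_⟩
  have t₁ := trilinear_le_of_lintegral_snd m₁ hh hf hg b₁
  have t₂ := trilinear_le_of_lintegral_fst m₂ hh hf hg b₂
  have t₃ := trilinear_le_of_lintegral_fst m₃ hh hf hg b₃
  have t₄ := trilinear_le_of_lintegral_diag m₄ hh hf hg b₄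
  have mi : ∀ K : Plane → Plane → ℝ≥0∞, Measurable (Function.uncurry K) →
      Measurable fun z : Plane × Plane => K z.1 z.2 * (f z.2 * g (z.2 - z.1)) := by
    intro K hK
    exact Measurable.mul hK (by fun_prop)
  have mo : ∀ K : Plane → Plane → ℝ≥0∞, Measurable (Function.uncurry K) →
      Measurable fun ζ => h ζ * ∫⁻ η, K ζ η * (f η * g (η - ζ)) := by
    intro K hK
    exact hh.mul (mi K hK).lintegral_prod_right'
  have ms : ∀ K : Plane → Plane → ℝ≥0∞, Measurable (Function.uncurry K) → ∀ ζ,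
      Measurable fun η => K ζ η * (f η * g (η - ζ)) := by
    intro K hK ζ
    exact (mi K hK).comp measurable_prodMk_left
  calc _ ≤ ∫⁻ ζ, ENNReal.ofReal C * (h ζ * (∫⁻ η, K₁ ζ η * (f η * g (η - ζ))) +
        h ζ * (∫⁻ η, K₂ ζ η * (f η * g (η - ζ))) + h ζ * (∫⁻ η, K₃ ζ η * (f η * g (η - ζ))) +
        h ζ * (∫⁻ η, K₄ ζ η * (f η * g (η - ζ)))) := by
        refine lintegral_mono fun ζ => ?_
        rw [← mul_add, ← mul_add, ← mul_add, ← lintegral_add_right _ (ms _ m₂ ζ),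
          ← lintegral_add_right _ (ms _ m₃ ζ), ← lintegral_add_right _ (ms _ m₄ ζ),
          mul_left_comm, ← lintegral_const_mul' _ _ ENNReal.ofReal_ne_top]
        gcongr h ζ * ?_
        refine lintegral_mono fun η => ?_
        refine (mul_le_mul_left (hle ζ η) _).trans (le_of_eq ?_)
        ring
    _ ≤ _ := by
        rw [lintegral_const_mul' _ _ ENNReal.ofReal_ne_top,
          lintegral_add_right _ (mo _ m₄), lintegral_add_right _ (mo _ m₃),
          lintegral_add_right _ (mo _ m₂), mul_assoc,
          add_mul, add_mul, add_mul]
        gcongr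

/-! ### From the kernel to weighted Fourier transforms -/

/-- The weight of the Bourgain space. -/
noncomputable def bourgainWeight (k b : ℝ) (ζ : Plane) : ℝ :=
  bracket (ζ 0) ^ k * bracket (ζ 1 + ζ 0 ^ 2 / 2) ^ b

/-- The weight of the mixed Sobolev space. -/
noncomputable def mixedWeight (r s : ℝ) (ζ : Plane) : ℝ :=
  bracket (ζ 0) ^ s * bracket (ζ 1) ^ r

lemma bourgainWeight_pos (k b : ℝ) (ζ : Plane) : 0 < bourgainWeight k b ζ :=
  mul_pos (bracket_rpow_pos _ _) (bracket_rpow_pos _ _)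

lemma mixedWeight_pos (r s : ℝ) (ζ : Plane) : 0 < mixedWeight r s ζ :=
  mul_pos (bracket_rpow_pos _ _) (bracket_rpow_pos _ _)

@[fun_prop]
lemma measurable_bourgainWeight (k b : ℝ) : Measurable (bourgainWeight k b) := by
  unfold bourgainWeight; fun_prop

@[fun_prop]
lemma measurable_mixedWeight (r s : ℝ) : Measurable (mixedWeight r s) := by
  unfold mixedWeight; fun_prop

lemma eLpNorm_two_eq_lintegral_sq {α E : Type*} [MeasurableSpace α] {μ : Measure α}
    [NormedAddCommGroup E] (f : α → E) :
    eLpNorm f 2 μ = (∫⁻ x, ‖f x‖ₑ ^ 2 ∂μ) ^ (1 / 2 : ℝ) := by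
  rw [eLpNorm_eq_lintegral_rpow_enorm_toReal (by norm_num) (by norm_num)]
  simp

/-- The bilinear estimate for the absolute values of the Fourier transforms. -/
theorem lintegral_mixedWeight_mul_le {k s a b : ℝ} (hs : s ≤ k + 1 / 2) (hb : 1 / 2 < b)
    (ha : max (1 / 4) (max 0 s - 2 * k) < a) (ha' : a < 1 / 2) :
    ∃ C : ℝ≥0, ∀ F G : Plane → ℂ, AEStronglyMeasurable F → AEStronglyMeasurable G →
      (∫⁻ ζ, (ENNReal.ofReal (mixedWeight (-a) s ζ) * ∫⁻ η, ‖F η‖ₑ * ‖G (η - ζ)‖ₑ) ^ 2) ^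
          (1 / 2 : ℝ) ≤
        C * eLpNorm (fun ζ => (bourgainWeight k b ζ : ℂ) * F ζ) 2 volume *
          eLpNorm (fun ζ => (bourgainWeight k b ζ : ℂ) * G ζ) 2 volume := by
  obtain ⟨C, hC, h⟩ := trilinear_productKernel_le hs hb ha ha'
  refine ⟨C.toNNReal, fun F G hF hG => ?_⟩
  rw [ENNReal.coe_toNNReal hC]
  set w := bourgainWeight k b with hw
  have hF' := hF.enorm
  have hG' := hG.enorm
  set F' := hF'.mk
  set G' := hG'.mk
  set f : Plane → ℝ≥0∞ := fun ζ => ENNReal.ofReal (w ζ) * F' ζ with hfdef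
  set g : Plane → ℝ≥0∞ := fun ζ => ENNReal.ofReal (w ζ) * G' ζ with hgdef
  have hfm : Measurable f := Measurable.mul (by fun_prop) hF'.measurable_mk
  have hgm : Measurable g := Measurable.mul (by fun_prop) hG'.measurable_mk
  have hN : ∀ (H : Plane → ℂ) (H' : Plane → ℝ≥0∞), (fun ζ => ‖H ζ‖ₑ) =ᵐ[volume] H' →
      eLpNorm (fun ζ => (w ζ : ℂ) * H ζ) 2 volume =
        (∫⁻ ζ, (ENNReal.ofReal (w ζ) * H' ζ) ^ 2) ^ (1 / 2 : ℝ) := by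
    intro H H' hHH'
    rw [eLpNorm_two_eq_lintegral_sq]
    congr 1
    refine lintegral_congr_ae ?_
    filter_upwards [hHH'] with ζ hζ
    rw [enorm_mul, hζ, ← ofReal_norm, Complex.norm_real,
      Real.norm_of_nonneg (bourgainWeight_pos k b ζ).le]
  rw [hN F F' hF'.ae_eq_mk, hN G G' hG'.ae_eq_mk]
  have hT : ∀ ζ, ENNReal.ofReal (mixedWeight (-a) s ζ) * ∫⁻ η, ‖F η‖ₑ * ‖G (η - ζ)‖ₑ =
      ∫⁻ η, productKernel k s a b ζ η * (f η * g (η - ζ)) := by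
    intro ζ
    rw [← lintegral_const_mul' _ _ ENNReal.ofReal_ne_top]
    refine lintegral_congr_ae ?_
    filter_upwards [hF'.ae_eq_mk,
      (measurePreserving_sub_right volume ζ).quasiMeasurePreserving.ae_eq hG'.ae_eq_mk] with η h1 h2
    simp only [Function.comp_apply] at h2
    -- The kernel is the output weight divided by the two input weights.
    have hcancel : productKernel k s a b ζ η * (ENNReal.ofReal (w η) * ENNReal.ofReal (w (η - ζ))) =
        ENNReal.ofReal (mixedWeight (-a) s ζ) := by
      have p := fun x q => (bracket_rpow_pos x q).le
      rw [productKernel, ← ENNReal.ofReal_mul (bourgainWeight_pos _ _ _).le,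
        ← ENNReal.ofReal_mul (mul_nonneg (mul_nonneg (mul_nonneg (p _ _) (p _ _))
          (mul_nonneg (p _ _) (p _ _))) (mul_nonneg (p _ _) (p _ _)))]
      congr 1
      simp only [hw, bourgainWeight, mixedWeight, PiLp.sub_apply]
      calc _ = bracket (ζ 0) ^ s * bracket (ζ 1) ^ (-a) *
            (bracket (η 0) ^ k * bracket (η 0) ^ (-k)) *
            (bracket (η 1 + η 0 ^ 2 / 2) ^ b * bracket (η 1 + η 0 ^ 2 / 2) ^ (-b)) *
            (bracket (η 0 - ζ 0) ^ k * bracket (η 0 - ζ 0) ^ (-k)) *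
            (bracket (η 1 - ζ 1 + (η 0 - ζ 0) ^ 2 / 2) ^ b *
              bracket (η 1 - ζ 1 + (η 0 - ζ 0) ^ 2 / 2) ^ (-b)) := by ring
        _ = _ := by simp only [bracket_rpow_mul_neg, mul_one]
    rw [h1, h2, ← hcancel]
    ring
  simp only [hT]
  refine lintegral_sq_le_of_forall_lintegral_mul_le ?_ fun φ hφ => ?_
  · exact Measurable.lintegral_prod_right' (f := fun z : Plane × Plane =>
      productKernel k s a b z.1 z.2 * (f z.2 * g (z.2 - z.1)))
      ((measurable_productKernel k s a b).mul (by fun_prop))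
  · refine (h φ f g hφ hfm hgm).trans (le_of_eq ?_)
    ring

/-! ### Fourier transforms that are functions -/

section FourierFunction

variable {u : 𝓢'(Plane, ℂ)} {F G : Plane → ℂ}

lemma two_pi_ne_zero : (2 * Real.pi) ≠ 0 := Real.two_pi_pos.ne'

/-- Integrability against a bump function equal to one near a point is integrability near that
point. -/
lemma HasFourierFunction.locallyIntegrable (h : HasFourierFunction u F) :
    LocallyIntegrable (fun η : Plane => F ((2 * Real.pi) • η)) volume := by
  intro x
  let φ : ContDiffBump x := ⟨1, 2, one_pos, one_lt_two⟩
  have hφ₁ : HasCompactSupport (Complex.ofRealCLM ∘ φ) := φ.hasCompactSupport.comp_left rfl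
  have hφ₂ : ContDiff ℝ ((⊤ : ℕ∞) : WithTop ℕ∞) (Complex.ofRealCLM ∘ φ) :=
    Complex.ofRealCLM.contDiff.comp φ.contDiff
  have hint := (h (hφ₁.toSchwartzMap hφ₂)).1
  refine ⟨Metric.closedBall x 1, Metric.closedBall_mem_nhds x one_pos,
    hint.integrableOn.congr_fun (fun η hη => ?_) Metric.isClosed_closedBall.measurableSet⟩
  simp [φ.one_of_mem_closedBall hη]

lemma ae_of_ae_two_pi_smul {p : Plane → Prop} (h : ∀ᵐ η : Plane, p ((2 * Real.pi) • η)) :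
    ∀ᵐ ζ : Plane, p ζ := by
  have := (Measure.quasiMeasurePreserving_smul (volume : Measure Plane)
    (inv_ne_zero two_pi_ne_zero)).ae h
  filter_upwards [this] with ζ hζ
  rwa [smul_inv_smul₀ two_pi_ne_zero] at hζ

lemma HasFourierFunction.aestronglyMeasurable (h : HasFourierFunction u F) :
    AEStronglyMeasurable F := by
  have := h.locallyIntegrable.aestronglyMeasurable.comp_quasiMeasurePreserving
    (Measure.quasiMeasurePreserving_smul (volume : Measure Plane) (inv_ne_zero two_pi_ne_zero))
  refine this.congr (Filter.Eventually.of_forall fun ζ => ?_)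
  simp only [Function.comp_apply, smul_inv_smul₀ two_pi_ne_zero]

/-- The Fourier transform is unique up to null sets. -/
lemma HasFourierFunction.ae_eq (h : HasFourierFunction u F) (h' : HasFourierFunction u G) :
    F =ᵐ[volume] G := by
  refine ae_of_ae_two_pi_smul (p := fun ζ => F ζ = G ζ) ?_
  refine ae_eq_of_integral_contDiff_smul_eq h.locallyIntegrable h'.locallyIntegrable
    fun g hg hgc => ?_
  have hg₁ : HasCompactSupport (Complex.ofRealCLM ∘ g) := hgc.comp_left rfl
  have hg₂ : ContDiff ℝ ((⊤ : ℕ∞) : WithTop ℕ∞) (Complex.ofRealCLM ∘ g) :=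
    Complex.ofRealCLM.contDiff.comp hg
  have := (h (hg₁.toSchwartzMap hg₂)).2.symm.trans (h' (hg₁.toSchwartzMap hg₂)).2
  simpa [mul_comm] using this

lemma weightedFourierNorm_eq (m : Plane → ℝ) (h : HasFourierFunction u F) :
    weightedFourierNorm m u = eLpNorm (fun ζ => (m ζ : ℂ) * F ζ) 2 volume := by
  refine le_antisymm (iInf₂_le F h) (le_iInf₂ fun G hG => le_of_eq (eLpNorm_congr_ae ?_))
  filter_upwards [h.ae_eq hG] with ζ hζ
  rw [hζ]

lemma schwartzConj_apply (φ : 𝓢(Plane, ℂ)) (z : Plane) : schwartzConj φ z = conj (φ z) := rfl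

/-- The reflection `φ(-·)` of a Schwartz function. -/
noncomputable def schwartzReflect (φ : 𝓢(Plane, ℂ)) : 𝓢(Plane, ℂ) :=
  compCLMOfContinuousLinearEquiv ℂ (LinearIsometryEquiv.neg ℝ (E := Plane)) φ

lemma schwartzReflect_apply (φ : 𝓢(Plane, ℂ)) (z : Plane) : schwartzReflect φ z = φ (-z) := rfl

lemma conj_fourier_apply (φ : 𝓢(Plane, ℂ)) (η : Plane) :
    conj ((𝓕 φ) η) = (𝓕 (schwartzConj (schwartzReflect φ))) η := by
  rw [fourier_coe, fourier_coe, Real.fourier_eq', Real.fourier_eq', ← integral_conj,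
    ← integral_neg_eq_self]
  congr 1
  ext v
  simp only [smul_eq_mul, map_mul, schwartzConj_apply, schwartzReflect_apply, ← Complex.exp_conj,
    Complex.conj_ofReal, Complex.conj_I, inner_neg_left]
  congr 2
  push_cast
  ring

lemma fourier_schwartzConj_apply (w : 𝓢(Plane, ℂ)) (η : Plane) :
    (𝓕 (schwartzConj w)) η = conj ((𝓕 w) (-η)) := by
  rw [fourier_coe, fourier_coe, Real.fourier_eq', Real.fourier_eq', ← integral_conj]
  congr 1
  ext v
  simp only [smul_eq_mul, map_mul, schwartzConj_apply, ← Complex.exp_conj,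
    Complex.conj_ofReal, Complex.conj_I, inner_neg_right]
  congr 2
  push_cast
  ring

lemma HasFourierFunction.distribConj (h : HasFourierFunction u F) :
    HasFourierFunction (distribConj u) (fun ζ => conj (F (-ζ))) := by
  intro φ
  obtain ⟨h1, h2⟩ := h (schwartzConj (schwartzReflect φ))
  have e : ∀ η : Plane, conj (F (-((2 * Real.pi) • η))) * φ η =
      conj (F ((2 * Real.pi) • (-η)) * schwartzConj (schwartzReflect φ) (-η)) := by
    intro η
    rw [map_mul, schwartzConj_apply, schwartzReflect_apply, Complex.conj_conj, neg_neg, smul_neg]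
  simp only [e]
  refine ⟨?_, ?_⟩
  · exact (Complex.conjLIE.toContinuousLinearEquiv.toContinuousLinearMap.integrable_comp
      h1).comp_neg
  · rw [integral_neg_eq_self (fun η => conj (F ((2 * Real.pi) • η) *
      schwartzConj (schwartzReflect φ) η)), integral_conj, ← h2]
    have e2 : schwartzConj (𝓕 φ) = 𝓕 (schwartzConj (schwartzReflect φ)) := by
      ext η
      exact conj_fourier_apply φ η
    change conj (u (schwartzConj (𝓕 φ))) = conj (u (𝓕 (schwartzConj (schwartzReflect φ))))
    rw [e2]

end FourierFunction

/-! ### Schwartz functions -/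

lemma hasFourierFunction_schwartz (u : 𝓢(Plane, ℂ)) :
    HasFourierFunction (u : 𝓢'(Plane, ℂ)) (fun ζ => (𝓕 u) ((2 * Real.pi)⁻¹ • ζ)) := by
  intro φ
  simp only [inv_smul_smul₀ two_pi_ne_zero]
  refine ⟨?_, ?_⟩
  · exact (schwartzMul (𝓕 u) φ).integrable
  · rw [TemperedDistribution.fourier_toTemperedDistributionCLM_eq, coe_apply]
    simp only [smul_eq_mul, mul_comm]

lemma fourier_fourier_apply (u : 𝓢(Plane, ℂ)) (x : Plane) : (𝓕 (𝓕 u)) x = u (-x) := by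
  have h : (𝓕⁻ (𝓕 u)) (-x) = (𝓕 (𝓕 u)) (- -x) := rfl
  rw [FourierTransform.fourierInv_fourier_eq, neg_neg] at h
  exact h.symm

/-- Applying `𝓕` again, the convolution becomes a product and `𝓕 𝓕` is reflection, so both sides
agree; `𝓕` is then inverted. -/
lemma fourier_schwartzMul_apply (u w : 𝓢(Plane, ℂ)) (η : Plane) :
    (𝓕 (schwartzMul u w)) η =
      MeasureTheory.convolution ⇑(𝓕 u : 𝓢(Plane, ℂ)) ⇑(𝓕 w : 𝓢(Plane, ℂ))
        (ContinuousLinearMap.mul ℂ ℂ) volume η := by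
  have h : 𝓕 (schwartzMul u w) =
      SchwartzMap.convolution (ContinuousLinearMap.mul ℂ ℂ) (𝓕 u) (𝓕 w) := by
    have h2 : 𝓕 (𝓕 (schwartzMul u w)) =
        𝓕 (SchwartzMap.convolution (ContinuousLinearMap.mul ℂ ℂ) (𝓕 u) (𝓕 w)) := by
      ext x
      rw [fourier_convolution, pairing_apply_apply, fourier_fourier_apply, fourier_fourier_apply,
        fourier_fourier_apply]
      rfl
    have h3 := congrArg (fun f : 𝓢(Plane, ℂ) => (𝓕⁻ f : 𝓢(Plane, ℂ))) h2
    simpa only [FourierTransform.fourierInv_fourier_eq] using h3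
  rw [h, SchwartzMap.convolution_apply]

lemma hasFourierFunction_schwartzMul (u w : 𝓢(Plane, ℂ)) :
    HasFourierFunction (schwartzMul u w : 𝓢(Plane, ℂ)) (fun ζ =>
      ((2 * Real.pi : ℝ) : ℂ)⁻¹ ^ 2 *
        MeasureTheory.convolution (fun ζ => (𝓕 u) ((2 * Real.pi)⁻¹ • ζ))
          (fun ζ => (𝓕 w) ((2 * Real.pi)⁻¹ • ζ)) (ContinuousLinearMap.mul ℂ ℂ) volume ζ) := by
  convert hasFourierFunction_schwartz (schwartzMul u w) using 2 with ζ
  rw [fourier_schwartzMul_apply, MeasureTheory.convolution, MeasureTheory.convolution]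
  -- The dilation between the two normalizations has Jacobian `(2π)²` in the plane, which cancels
  -- the prefactor.
  have h := Measure.integral_comp_smul (volume : Measure Plane)
    (fun t => (ContinuousLinearMap.mul ℂ ℂ) ((𝓕 u) t) ((𝓕 w) ((2 * Real.pi)⁻¹ • ζ - t)))
    (2 * Real.pi)⁻¹
  simp only [smul_sub] at h ⊢
  rw [h]
  have hfr : Module.finrank ℝ Plane = 2 := by simp
  rw [hfr, abs_of_pos (by positivity), Complex.real_smul, ← mul_assoc]
  have : ((2 * Real.pi : ℝ) : ℂ) ≠ 0 := by exact_mod_cast two_pi_ne_zero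
  push_cast at this ⊢
  field_simp

/-! ### Tempered distributions with prescribed Fourier transform -/

lemma bracket_two_pi_smul_le (η : Plane) (i : Fin 2) :
    bracket (((2 * Real.pi) • η) i) ≤ 16 * (1 + ‖η‖ ^ 2) := by
  have h1 : |η i| ≤ ‖η‖ := by simpa using PiLp.norm_apply_le η i
  have h2 : Real.pi ≤ 3.15 := Real.pi_lt_d2.le
  rw [bracket, PiLp.smul_apply, smul_eq_mul, abs_mul, abs_of_pos Real.two_pi_pos]
  have h3 : 2 * Real.pi * |η i| ≤ 7 * ‖η‖ :=
    mul_le_mul (by linarith) h1 (abs_nonneg _) (by norm_num)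
  nlinarith [sq_nonneg (‖η‖ - 1)]

/-- The mixed weight decays at most polynomially, whatever the signs of `r` and `s`; hence weighted
`L²` functions are tempered. -/
lemma japanese_rpow_neg_le_mixedWeight (r s : ℝ) (η : Plane) :
    (1 + ‖η‖ ^ 2) ^ (-(|s| + |r|)) ≤
      16 ^ (|s| + |r|) * mixedWeight r s ((2 * Real.pi) • η) := by
  set J := 1 + ‖η‖ ^ 2 with hJ
  have hJ0 : 0 < J := by positivity
  have key : ∀ (i : Fin 2) (p : ℝ),
      (16 * J) ^ (-|p|) ≤ bracket (((2 * Real.pi) • η) i) ^ p := by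
    intro i p
    calc (16 * J) ^ (-|p|) ≤ bracket (((2 * Real.pi) • η) i) ^ (-|p|) :=
          Real.rpow_le_rpow_of_nonpos (bracket_pos _) (bracket_two_pi_smul_le η i)
            (by simp)
      _ ≤ _ := bracket_rpow_le_rpow (neg_abs_le p) _
  calc J ^ (-(|s| + |r|)) = 16 ^ (|s| + |r|) * ((16 * J) ^ (-|s|) * (16 * J) ^ (-|r|)) := by
        rw [← Real.rpow_add (by positivity), ← neg_add, Real.mul_rpow (by norm_num) hJ0.le,
          ← mul_assoc, ← Real.rpow_add (by norm_num)]
        simp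
    _ ≤ _ := by
        rw [mixedWeight]
        gcongr
        · exact (bracket_rpow_pos _ _).le
        · exact key 0 s
        · exact key 1 r

/-- A function with a finite weighted `L²` norm is the Fourier transform of a tempered
distribution. -/
lemma exists_hasFourierFunction {H : Plane → ℂ} {r s : ℝ}
    (hH : MemLp (fun ζ => (mixedWeight r s ζ : ℂ) * H ζ) 2 volume)
    (hHm : AEStronglyMeasurable H) :
    ∃ v : 𝓢'(Plane, ℂ), HasFourierFunction v H := by
  set N := |s| + |r| with hN
  have hHm' : AEStronglyMeasurable (fun η : Plane => H ((2 * Real.pi) • η)) :=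
    hHm.comp_quasiMeasurePreserving
      (Measure.quasiMeasurePreserving_smul (volume : Measure Plane) two_pi_ne_zero)
  have hH' : MemLp (fun η : Plane => (mixedWeight r s ((2 * Real.pi) • η) : ℂ) *
      H ((2 * Real.pi) • η)) 2 volume := by
    refine MemLp.comp_of_map (g := fun ζ => (mixedWeight r s ζ : ℂ) * H ζ)
      (f := fun η : Plane => (2 * Real.pi) • η) ?_
      (measurable_const_smul _).aemeasurable
    rw [Measure.map_addHaar_smul _ two_pi_ne_zero]
    exact hH.smul_measure ENNReal.ofReal_ne_top
  set J : Plane → ℝ := fun η => 1 + ‖η‖ ^ 2 with hJ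
  have hJ0 : ∀ η, 0 < J η := fun η => by simp only [hJ]; positivity
  have hJm : Continuous J := by fun_prop
  have hg : MemLp (fun η : Plane => ((J η ^ (-N) : ℝ) : ℂ) * H ((2 * Real.pi) • η)) 2 volume := by
    refine hH'.of_le_mul (c := 16 ^ N) ?_ (Filter.Eventually.of_forall fun η => ?_)
    · refine AEStronglyMeasurable.mul ?_ hHm'
      exact (Complex.continuous_ofReal.comp
        (hJm.rpow_const fun η => Or.inl (hJ0 η).ne')).aestronglyMeasurable
    · rw [norm_mul, norm_mul, Complex.norm_real, Complex.norm_real, ← mul_assoc,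
        Real.norm_of_nonneg (Real.rpow_nonneg (hJ0 η).le _),
        Real.norm_of_nonneg (mixedWeight_pos _ _ _).le]
      gcongr
      exact japanese_rpow_neg_le_mixedWeight r s η
  have htg : (fun η : Plane => ((J η ^ N : ℝ) : ℂ)).HasTemperateGrowth :=
    Function.HasTemperateGrowth.comp Complex.ofRealCLM.hasTemperateGrowth
      (Function.hasTemperateGrowth_one_add_norm_sq_rpow Plane N)
  have hcancel : ∀ (φ : 𝓢(Plane, ℂ)) (η : Plane), H ((2 * Real.pi) • η) * φ η =
      SchwartzMap.smulLeftCLM ℂ (fun η : Plane => ((J η ^ N : ℝ) : ℂ)) φ η *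
        (((J η ^ (-N) : ℝ) : ℂ) * H ((2 * Real.pi) • η)) := by
    intro φ η
    have h1 : ((J η ^ N : ℝ) : ℂ) * ((J η ^ (-N) : ℝ) : ℂ) = 1 := by
      rw [← Complex.ofReal_mul, ← Real.rpow_add (hJ0 η)]
      simp
    rw [SchwartzMap.smulLeftCLM_apply_apply htg, smul_eq_mul]
    linear_combination (-(φ η * H ((2 * Real.pi) • η))) * h1
  -- `J ^ (-N) H(2π ·)` is in `L²`, hence a tempered distribution; `J ^ N` has temperate growth, so
  -- multiplying back stays tempered.
  refine ⟨𝓕⁻ (TemperedDistribution.smulLeftCLM ℂ (fun η : Plane => ((J η ^ N : ℝ) : ℂ))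
    (Lp.toTemperedDistribution hg.toLp)), fun φ => ?_⟩
  simp only [hcancel]
  refine ⟨(SchwartzMap.memLp _ 2 volume).integrable_mul hg, ?_⟩
  rw [FourierTransform.fourier_fourierInv_eq, TemperedDistribution.smulLeftCLM_apply_apply,
    Lp.toTemperedDistribution_apply]
  refine integral_congr_ae ?_
  filter_upwards [hg.coeFn_toLp] with η hη
  rw [hη, smul_eq_mul]

/-! ### The product -/

lemma measurable_lintegral_mul_sub {f g : Plane → ℝ≥0∞} (hf : AEMeasurable f)
    (hg : AEMeasurable g) : Measurable fun ζ => ∫⁻ η, f η * g (η - ζ) := by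
  have h : ∀ ζ, ∫⁻ η, f η * g (η - ζ) = ∫⁻ η, hf.mk f η * hg.mk g (η - ζ) := by
    intro ζ
    refine lintegral_congr_ae ?_
    filter_upwards [hf.ae_eq_mk,
      (measurePreserving_sub_right volume ζ).quasiMeasurePreserving.ae_eq hg.ae_eq_mk] with η h1 h2
    simp only [Function.comp_apply] at h2
    rw [h1, h2]
  simp only [h]
  have hf' := hf.measurable_mk
  have hg' := hg.measurable_mk
  exact Measurable.lintegral_prod_right' (f := fun z : Plane × Plane =>
    hf.mk f z.2 * hg.mk g (z.2 - z.1)) (by fun_prop)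

/-- The product formula `(2π)⁻² F ∗ G*`, where `G* = conj G(-·)` is the Fourier transform of the
conjugate. -/
noncomputable def productFourier (F G : Plane → ℂ) (ζ : Plane) : ℂ :=
  ((2 * Real.pi : ℝ) : ℂ)⁻¹ ^ 2 *
    convolution F (fun ζ => conj (G (-ζ))) (ContinuousLinearMap.mul ℂ ℂ) volume ζ

lemma enorm_mul_conj_neg_sub (F G : Plane → ℂ) (ζ η : Plane) :
    ‖F η * conj (G (-(ζ - η)))‖ₑ = ‖F η‖ₑ * ‖G (η - ζ)‖ₑ := by
  rw [enorm_mul, neg_sub, ← ofReal_norm (conj _), RCLike.norm_conj, ofReal_norm]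

/-- The factor `(2π)⁻²` is at most one and is dropped. -/
lemma enorm_productFourier_le (F G : Plane → ℂ) (ζ : Plane) :
    ‖productFourier F G ζ‖ₑ ≤ ∫⁻ η, ‖F η‖ₑ * ‖G (η - ζ)‖ₑ := by
  have h1 : ‖((2 * Real.pi : ℝ) : ℂ)⁻¹ ^ 2‖ₑ ≤ 1 := by
    rw [← ofReal_norm, norm_pow, norm_inv, Complex.norm_real,
      Real.norm_of_nonneg Real.two_pi_pos.le, ENNReal.ofReal_le_one]
    refine pow_le_one₀ (by positivity) (inv_le_one_of_one_le₀ ?_)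
    linarith [Real.pi_gt_three]
  rw [productFourier, enorm_mul]
  refine (mul_le_of_le_one_left' h1).trans ((enorm_integral_le_lintegral_enorm _).trans ?_)
  refine lintegral_mono fun η => le_of_eq ?_
  exact enorm_mul_conj_neg_sub F G ζ η

lemma eLpNorm_mixedWeight_productFourier_le (r s : ℝ) (F G : Plane → ℂ) :
    eLpNorm (fun ζ => (mixedWeight r s ζ : ℂ) * productFourier F G ζ) 2 volume ≤
      (∫⁻ ζ, (ENNReal.ofReal (mixedWeight r s ζ) * ∫⁻ η, ‖F η‖ₑ * ‖G (η - ζ)‖ₑ) ^ 2) ^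
        (1 / 2 : ℝ) := by
  rw [eLpNorm_two_eq_lintegral_sq]
  gcongr with ζ
  rw [enorm_mul, ← ofReal_norm, Complex.norm_real, Real.norm_of_nonneg (mixedWeight_pos r s ζ).le]
  gcongr
  exact enorm_productFourier_le F G ζ

/-- A function with finite `L²` norm is finite almost everywhere, and the weight is positive, so
finiteness passes to the unweighted integral. -/
lemma ae_lintegral_mul_sub_lt_top {r s : ℝ} {F G : Plane → ℂ} (hF : AEStronglyMeasurable F)
    (hG : AEStronglyMeasurable G)
    (h : (∫⁻ ζ, (ENNReal.ofReal (mixedWeight r s ζ) * ∫⁻ η, ‖F η‖ₑ * ‖G (η - ζ)‖ₑ) ^ 2) ^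
        (1 / 2 : ℝ) ≠ ∞) :
    ∀ᵐ ζ : Plane, ∫⁻ η, ‖F η‖ₑ * ‖G (η - ζ)‖ₑ < ∞ := by
  have hm := measurable_lintegral_mul_sub hF.enorm hG.enorm
  have h' : ∫⁻ ζ, (ENNReal.ofReal (mixedWeight r s ζ) * ∫⁻ η, ‖F η‖ₑ * ‖G (η - ζ)‖ₑ) ^ 2 ≠ ∞ := by
    intro h0
    rw [h0, ENNReal.top_rpow_of_pos (by norm_num)] at h
    exact h rfl
  filter_upwards [ae_lt_top (by fun_prop) h'] with ζ hζ
  rw [lt_top_iff_ne_top]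
  intro h0
  rw [h0, ENNReal.mul_top (by simpa using mixedWeight_pos r s ζ)] at hζ
  simp at hζ

lemma convolutionExistsAt_of_lintegral_lt_top {F G : Plane → ℂ} (hF : AEStronglyMeasurable F)
    (hG : AEStronglyMeasurable fun ζ => conj (G (-ζ))) {ζ : Plane}
    (h : ∫⁻ η, ‖F η‖ₑ * ‖G (η - ζ)‖ₑ < ∞) :
    ConvolutionExistsAt F (fun ζ => conj (G (-ζ))) ζ (ContinuousLinearMap.mul ℂ ℂ) volume := by
  refine ⟨hF.convolution_integrand_snd _ hG ζ,
    lt_of_le_of_lt (lintegral_mono fun η => le_of_eq ?_) h⟩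
  exact enorm_mul_conj_neg_sub F G ζ η

lemma aestronglyMeasurable_productFourier {F G : Plane → ℂ} (hF : AEStronglyMeasurable F)
    (hG : AEStronglyMeasurable fun ζ => conj (G (-ζ))) :
    AEStronglyMeasurable (productFourier F G) := by
  refine AEStronglyMeasurable.const_mul ?_ _
  exact (hF.convolution_integrand (ContinuousLinearMap.mul ℂ ℂ) hG).integral_prod_right'

theorem proposition3p3 (k s a b : ℝ)
    (hsk : max 0 s < 2 * k + 1 / 2) (hs : s ≤ k + 1 / 2) (hb : 1 / 2 < b)
    (ha : max (1 / 4) (max 0 s - 2 * k) < a) (ha' : a < 1 / 2) :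
    ∃ C : ℝ≥0,
      (∀ u w : 𝓢(Plane, ℂ),
        mixedSobolevNorm (-a) s (schwartzMul u (schwartzConj w) : 𝓢(Plane, ℂ)) ≤
          C * bourgainNorm k b u * bourgainNorm k b w) ∧
      (∀ u w : 𝓢'(Plane, ℂ), bourgainNorm k b u < ∞ → bourgainNorm k b w < ∞ →
        ∃ v : 𝓢'(Plane, ℂ), IsProduct u (distribConj w) v ∧
          mixedSobolevNorm (-a) s v ≤ C * bourgainNorm k b u * bourgainNorm k b w) := by
  obtain ⟨C, hC⟩ := lintegral_mixedWeight_mul_le hs hb ha ha'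
  -- The estimate depends only on the Fourier functions, so it serves both halves; what differs is
  -- how `v` is obtained.
  have hbound : ∀ {u w v : 𝓢'(Plane, ℂ)} {F G : Plane → ℂ}, HasFourierFunction u F →
      HasFourierFunction w G → HasFourierFunction v (productFourier F G) →
      mixedSobolevNorm (-a) s v ≤ C * bourgainNorm k b u * bourgainNorm k b w := by
    intro u w v F G hF hG hv
    calc mixedSobolevNorm (-a) s v
        = eLpNorm (fun ζ => (mixedWeight (-a) s ζ : ℂ) * productFourier F G ζ) 2 volume :=
          weightedFourierNorm_eq (mixedWeight (-a) s) hv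
      _ ≤ C * eLpNorm (fun ζ => (bourgainWeight k b ζ : ℂ) * F ζ) 2 volume *
          eLpNorm (fun ζ => (bourgainWeight k b ζ : ℂ) * G ζ) 2 volume :=
          (eLpNorm_mixedWeight_productFourier_le _ _ F G).trans
            (hC F G hF.aestronglyMeasurable hG.aestronglyMeasurable)
      _ = _ := by
          rw [← weightedFourierNorm_eq (bourgainWeight k b) hF,
            ← weightedFourierNorm_eq (bourgainWeight k b) hG]
          rfl
  refine ⟨C, fun u w => ?_, fun u w hu hw => ?_⟩
  · refine hbound (hasFourierFunction_schwartz u) (hasFourierFunction_schwartz w) ?_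
    have h := hasFourierFunction_schwartzMul u (schwartzConj w)
    simp only [fourier_schwartzConj_apply, ← smul_neg] at h
    exact h
  · have exists_fun : ∀ {v : 𝓢'(Plane, ℂ)}, bourgainNorm k b v < ∞ →
        ∃ F, HasFourierFunction v F ∧
          eLpNorm (fun ζ => (bourgainWeight k b ζ : ℂ) * F ζ) 2 volume < ∞ := by
      intro v hv
      obtain ⟨F, hF⟩ := iInf_lt_iff.1 hv
      obtain ⟨hF, hF'⟩ := iInf_lt_iff.1 hF
      exact ⟨F, hF, hF'⟩
    obtain ⟨F, hF, hF'⟩ := exists_fun hu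
    obtain ⟨G, hG, hG'⟩ := exists_fun hw
    have hFm := hF.aestronglyMeasurable
    have hGm := hG.aestronglyMeasurable
    have hGc := hG.distribConj
    have hGcm := hGc.aestronglyMeasurable
    have hfin := (hC F G hFm hGm).trans_lt
      (ENNReal.mul_lt_top (ENNReal.mul_lt_top ENNReal.coe_lt_top hF') hG')
    have hPm := aestronglyMeasurable_productFourier hFm hGcm
    obtain ⟨v, hv⟩ := exists_hasFourierFunction (r := -a) (s := s) (H := productFourier F G)
      ⟨((measurable_mixedWeight (-a) s).complex_ofReal.aestronglyMeasurable).mul hPm,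
        (eLpNorm_mixedWeight_productFourier_le _ _ F G).trans_lt hfin⟩ hPm
    refine ⟨v, ⟨F, _, hF, hGc, ?_, hv⟩, hbound hF hG hv⟩
    filter_upwards [ae_lintegral_mul_sub_lt_top hFm hGm hfin.ne] with ζ hζ
    exact convolutionExistsAt_of_lintegral_lt_top hFm hGcm hζ
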